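/- For $0<H<1$ let $b_H$ be fractional Brownian motion on $\mathbb R$, i.e. a Gaussian process with $b_H(0)=0$, zero mean, $E|b_H(x)-b_H(y)|^2=|x-y|^{2H}$ and almost surely continuous paths. Let $$y_1(t)=\sqrt{2H+2}\int_0^t b_H(s)\,ds,\qquad M_H=\max_{t\in[0,1]}y_1(t),\qquad F_M(x\mid H)=P(M_H\le x).$$ The words "increases" and "decreases" are used in the non-strict sense. (a) For every fixed $x>0$, $F_M(x\mid H)$ increases with $H$ on $(1/2,1)$: if $1/2<H_0<H<1$, then $F_M(x\mid H_0)\le F_M(x\mid H)$. (b) Let $S\subseteq(1/2,1)$ (for instance $S=(1/2,1)$), and suppose that for every $H\in S$ there are $\theta(H)\in\mathbb R$ and a function $L_H$ slowly varying at $0$ (that is, measurable and positive on some interval $(0,\delta)$, with $L_H(cx)/L_H(x)\to1$ as $x\downarrow0$ for every $c>0$) such that $F_M(x^{1+H}\mid H)=x^{\theta(H)}L_H(x)$ for all sufficiently small $x>0$. Then $\theta(H)/(1+H)$ decreases with $H$ on $S$: if $H_0<H$ are in $S$, then $\theta(H)/(1+H)\le\theta(H_0)/(1+H_0)$. -/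

import Mathlib

open MeasureTheory ProbabilityTheory Set Filter Topology

/-- `b : ℝ → Ω → ℝ` is a fractional Brownian motion on the real line with similarity parameter
(Hurst index) `H` under `P`: a Gaussian process starting at `0`, with zero mean, structure function
`E |b x - b y| ^ 2 = |x - y| ^ (2 H)`, and almost surely continuous paths. (A Gaussian process in
Mathlib's sense lives on a probability space.) -/
structure IsFractionalBrownianMotion {Ω : Type*} [MeasurableSpace Ω] (H : ℝ) (b : ℝ → Ω → ℝ)
    (P : Measure Ω) : Prop where
  isGaussianProcess : IsGaussianProcess b P
  start_zero : ∀ᵐ ω ∂P, b 0 ω = 0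
  mean_zero : ∀ x : ℝ, ∫ ω, b x ω ∂P = 0
  structure_function : ∀ x y : ℝ, ∫ ω, (b x ω - b y ω) ^ 2 ∂P = |x - y| ^ (2 * H)
  continuous_paths : ∀ᵐ ω ∂P, Continuous fun x => b x ω

/-- The normalized integral `y₁(t) = √(2H + 2) ∫₀ᵗ b(s) ds` of a process `b`. -/
noncomputable def normalizedIntegral {Ω : Type*} (H : ℝ) (b : ℝ → Ω → ℝ) (t : ℝ) (ω : Ω) : ℝ :=
  Real.sqrt (2 * H + 2) * ∫ s in (0 : ℝ)..t, b s ω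

/-- The maximum of `y₁` over `[0, 1]`. For a continuous path of `b` the function `y₁` is
continuous, so the supremum is attained. -/
noncomputable def maxNormalizedIntegral {Ω : Type*} (H : ℝ) (b : ℝ → Ω → ℝ) (ω : Ω) : ℝ :=
  sSup ((fun t => normalizedIntegral H b t ω) '' Icc (0 : ℝ) 1)

/-- The distribution function `F_M(x | H) = P(max_{[0,1]} y₁ ≤ x)`. -/
noncomputable def maxDistribution {Ω : Type*} [MeasurableSpace Ω] (P : Measure Ω) (H : ℝ)
    (b : ℝ → Ω → ℝ) (x : ℝ) : ℝ :=
  P.real {ω | maxNormalizedIntegral H b ω ≤ x}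

/-- `L` is slowly varying at `0+`: it is measurable and positive on some interval `(0, δ)`, and
`L (c x) / L x → 1` as `x ↓ 0`, for every `c > 0`. -/
def IsSlowlyVaryingAtZero (L : ℝ → ℝ) : Prop :=
  (∃ δ > 0, Measurable ((Ioo (0 : ℝ) δ).domRestrict L) ∧ ∀ x ∈ Ioo (0 : ℝ) δ, 0 < L x) ∧
    ∀ c > 0, Tendsto (fun x => L (c * x) / L x) (𝓝[>] 0) (𝓝 1)

/-! The proof compares two Gaussian processes after a change of time. Since `y₁` is self-similar of
index `1 + H`, the process `s ↦ y₁ (s ^ (1 / (1 + H)))` has variance `s ^ 2` for every `H`, and the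
change of time maps `[0, 1]` onto itself, so the maximum is unaffected. For `σ ≤ τ` its covariance
is `τ ^ 2 * integratedCovariance (σ / τ) (1 + H)`.

The crux is that this covariance increases with `H` on `(1/2, 1)`
(`monotoneOn_integratedCovariance`); the sign of its derivative comes from `entropy_inequality`.
Variances being equal, Slepian's inequality (`measureReal_forall_le_le_of_covariance_le`) compares
the probabilities of staying below a level at finitely many times. Exhausting a dense sequence of
times gives (a), in `maxDistribution_le_of_le`.

For (b), both distribution functions are written in one variable `z`. If the normalized exponent
strictly increased, (a) would bound a quotient of slowly varying functions by a positive power of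
`z`, which `IsSlowlyVaryingAtZero.not_eventually_div_le` excludes. -/

/-! ### Monotonicity of the covariance in the similarity parameter. -/

/-- The exponential `j ↦ x ^ (m + j)` lies below its chord over `[0, 1]`. -/
lemma rpow_add_le_mul {x j : ℝ} (hx : 0 < x) (hj0 : 0 ≤ j) (hj1 : j ≤ 1) (m : ℝ) :
    x ^ (m + j) ≤ x ^ m * (1 - j * (1 - x)) := by
  rw [Real.rpow_add hx]
  have h := Real.geom_mean_le_arith_mean2_weighted (w₁ := 1 - j) (w₂ := j) (p₁ := 1) (p₂ := x)
    (by linarith) hj0 zero_le_one hx.le (by ring)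
  rw [Real.one_rpow, one_mul] at h
  gcongr
  linarith

/-- With `t = a ^ (1 / p)` and `k = 2 * p - 1`, four times this expression is the numerator of the
`p`-derivative of `integratedCovariance a p`. Linear bounds remove the logarithms, chord bounds in
the exponent remove the powers, and a polynomial inequality is left. -/
lemma entropy_inequality {t k : ℝ} (ht0 : 0 < t) (ht1 : t < 1) (hk2 : 2 ≤ k) (hk3 : k ≤ 3) :
    0 ≤ (1 - t) * (1 - t ^ k - (1 - t) ^ k) +
      k * (-(t * Real.log t * (1 - (1 - t) ^ k)) + t ^ k * Real.log t +
        (1 - t) ^ k * ((1 - t) * Real.log (1 - t))) := by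
  obtain ⟨u, rfl⟩ : ∃ u, t = 1 - u := ⟨1 - t, by ring⟩
  obtain ⟨j, rfl⟩ : ∃ j, k = 2 + j := ⟨k - 2, by ring⟩
  have hu0 : 0 < u := by linarith
  have hu1 : u < 1 := by linarith
  have hj0 : 0 ≤ j := by linarith
  have hj1 : j ≤ 1 := by linarith
  rw [sub_sub_cancel]
  set t := 1 - u with ht
  have htk : t ^ (2 + j) ≤ t ^ 2 * (1 - j * u) := by
    have := rpow_add_le_mul ht0 hj0 hj1 2
    rw [Real.rpow_two] at this
    linarith [this, show 1 - t = u by rw [ht]; ring, congrArg (fun z => t ^ 2 * (1 - j * z))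
      (show 1 - t = u by rw [ht]; ring)]
  have htk1 : t ^ (2 + j) = t * t ^ (1 + j) := by
    rw [show (2 : ℝ) + j = 1 + (1 + j) by ring, Real.rpow_add ht0, Real.rpow_one]
  have huk : u ^ (1 + j) ≤ u * (1 - j * t) := by
    simpa using rpow_add_le_mul hu0 hj0 hj1 1
  have huk1 : u ^ (2 + j) = u * u ^ (1 + j) := by
    rw [show (2 : ℝ) + j = 1 + (1 + j) by ring, Real.rpow_add hu0, Real.rpow_one]
  have htj : t ^ (1 + j) ≤ t := by
    simpa using Real.rpow_le_rpow_of_exponent_ge ht0 ht1.le (show (1 : ℝ) ≤ 1 + j by linarith)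
  have huj : u ^ (1 + j) ≤ u := by
    simpa using Real.rpow_le_rpow_of_exponent_ge hu0 hu1.le (show (1 : ℝ) ≤ 1 + j by linarith)
  have hlogt : Real.log t ≤ -u := by linarith [Real.log_le_sub_one_of_pos ht0]
  have hlogu : -t ≤ u * Real.log u := by
    have := Real.one_sub_inv_le_log_of_pos hu0
    have h2 := mul_le_mul_of_nonneg_left this hu0.le
    rw [mul_sub, mul_inv_cancel₀ hu0.ne'] at h2
    linarith
  set A := t ^ (1 + j)
  set B := u ^ (1 + j)
  have hA0 : 0 < A := Real.rpow_pos_of_pos ht0 _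
  have hB0 : 0 < B := Real.rpow_pos_of_pos hu0 _
  rw [htk1] at htk ⊢
  rw [huk1]
  -- The coefficient of `log t` is `-t * (1 - u * B - A) ≤ 0`, so an upper bound on `log t` is what
  -- is needed; in `h2` the coefficient of `u * log u` is nonnegative.
  have h1 : t * u * (1 - u * B - A) ≤ -(t * Real.log t * (1 - u * B)) + t * A * Real.log t := by
    have : 0 ≤ 1 - u * B - A := by nlinarith
    nlinarith [mul_nonneg (mul_nonneg ht0.le this) (sub_nonneg.2 hlogt)]
  have h2 : -(u * B * t) ≤ u * B * (u * Real.log u) := by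
    nlinarith [mul_nonneg (mul_nonneg hu0.le hB0.le) (sub_nonneg.2 hlogu)]
  have h3 : 0 ≤ u * (1 - t * A - u * B) + (2 + j) * (t * u * (1 - u * B - A) - u * B * t) := by
    -- The powers `t * A` and `B` enter with nonpositive coefficients, so their chord bounds may be
    -- substituted. On `t + u = 1` the result factors with `t ^ 2 * u`.
    have hpoly : 0 ≤ 1 - (3 + j) * (t ^ 2 * (1 - j * u)) + (2 + j) * t -
        u * (1 - j * t) * (u + (2 + j) * t * u + (2 + j) * t) := by
      have : 1 - (3 + j) * (t ^ 2 * (1 - j * u)) + (2 + j) * t -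
        u * (1 - j * t) * (u + (2 + j) * t * u + (2 + j) * t) =
          t ^ 2 * u * (2 + 7 * j + 3 * j ^ 2 - (j ^ 2 + 2 * j) * t) := by
        rw [ht]; ring
      rw [this]
      have : 0 ≤ 2 + 7 * j + 3 * j ^ 2 - (j ^ 2 + 2 * j) * t := by nlinarith
      positivity
    have e : u * (1 - t * A - u * B) + (2 + j) * (t * u * (1 - u * B - A) - u * B * t) =
      u * (1 - (3 + j) * (t * A) + (2 + j) * t - B * (u + (2 + j) * t * u + (2 + j) * t)) := by ring
    rw [e]
    refine mul_nonneg hu0.le (hpoly.trans ?_)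
    have : 0 ≤ u + (2 + j) * t * u + (2 + j) * t := by positivity
    gcongr
  nlinarith [mul_le_mul_of_nonneg_left (add_le_add h1 h2) (show (0 : ℝ) ≤ 2 + j by linarith)]

/-- The correlation of the integrated fractional Brownian motion of index `p - 1` at the times
`a ^ (1 / p)` and `1`, times the standard deviation `a` at the first of them. -/
noncomputable def integratedCovariance (a p : ℝ) : ℝ :=
  (2 * p * (a ^ (1 / p) + a ^ 2 / a ^ (1 / p)) - 1 - a ^ 2 + (1 - a ^ (1 / p)) ^ (2 * p)) /
    (2 * (2 * p - 1))

lemma monotoneOn_integratedCovariance {a : ℝ} (ha0 : 0 < a) (ha1 : a < 1) :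
    MonotoneOn (integratedCovariance a) (Icc (3 / 2) 2) := by
  have key : ∀ p ∈ Icc (3 / 2 : ℝ) 2, ∃ d, 0 ≤ d ∧ HasDerivAt (integratedCovariance a) d p := by
    rintro p ⟨hp1, hp2⟩
    have hp : 0 < p := by linarith
    set t := a ^ (1 / p) with ht
    have ht0 : 0 < t := Real.rpow_pos_of_pos ha0 _
    have ht1 : t < 1 := Real.rpow_lt_one ha0.le ha1 (by positivity)
    have hlog : Real.log a = p * Real.log t := by
      rw [ht, Real.log_rpow ha0]; field_simp
    have hat : a = t ^ p := by
      rw [ht, ← Real.rpow_mul ha0.le]; field_simp; simp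
    have hd1 : HasDerivAt (fun p : ℝ => a ^ (1 / p)) (-(t * Real.log t / p)) p := by
      have := ((hasDerivAt_inv hp.ne').const_rpow ha0)
      simp only [one_div] at ht ⊢
      refine this.congr_deriv ?_
      rw [← ht, hlog]
      field_simp
    have hd2 : HasDerivAt (fun p : ℝ => (1 - a ^ (1 / p)) ^ (2 * p))
        ((t * Real.log t / p) * (2 * p) * (1 - t) ^ (2 * p - 1) +
          2 * (1 - t) ^ (2 * p) * Real.log (1 - t)) p := by
      have := (hd1.const_sub 1).rpow ((hasDerivAt_id p).const_mul 2) (by rw [← ht]; linarith)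
      refine this.congr_deriv ?_
      rw [← ht]
      simp only [id]
      ring
    have hd3 := (((((hasDerivAt_id p).const_mul 2).mul
      (hd1.add ((hasDerivAt_const p (a ^ 2)).div hd1 ht0.ne'))).sub_const 1).sub_const (a ^ 2)).add
        hd2 |>.div (((((hasDerivAt_id p).const_mul 2)).sub_const 1).const_mul 2)
        (by simp only [id]; linarith)
    refine ⟨_, ?_, hd3⟩
    refine div_nonneg ?_ (sq_nonneg _)
    simp only [id, ← ht, Pi.add_apply, Pi.mul_apply, Pi.div_apply]
    have hk := entropy_inequality (k := 2 * p - 1) ht0 ht1 (by linarith) (by linarith)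
    have e1 : (1 - t) ^ (2 * p) = (1 - t) ^ (2 * p - 1) * (1 - t) := by
      rw [← Real.rpow_add_one (by linarith)]; ring_nf
    have e2 : a ^ 2 = t ^ (2 * p - 1) * t := by
      rw [← Real.rpow_add_one ht0.ne', hat, ← Real.rpow_natCast, ← Real.rpow_mul ht0.le]
      congr 1; push_cast; ring
    rw [e1, e2]
    -- Once `a ^ 2 = t ^ (2 * p)` is substituted, the numerator of the quotient rule is exactly four
    -- times the entropy expression.
    refine (mul_nonneg (show (0 : ℝ) ≤ 4 by norm_num) hk).trans_eq ?_
    field_simp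
    ring
  refine monotoneOn_of_deriv_nonneg (convex_Icc _ _) ?_ ?_ ?_
  · intro p hp
    obtain ⟨d, -, h⟩ := key p hp
    exact h.continuousAt.continuousWithinAt
  · intro p hp
    obtain ⟨d, -, h⟩ := key p (interior_subset hp)
    exact h.differentiableAt.differentiableWithinAt
  · intro p hp
    obtain ⟨d, h0, h⟩ := key p (interior_subset hp)
    rwa [h.deriv]

/-! ### Limits of Gaussian variables, and correlation by regression. -/

/-- The almost sure limit of centered Gaussian random variables is a centered Gaussian random
variable, and the variances converge. -/
lemma hasGaussianLaw_of_tendsto_ae {Ω : Type*} [MeasurableSpace Ω] {P : Measure Ω}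
    {Z : ℕ → Ω → ℝ} {Y : Ω → ℝ} (hZ : ∀ n, HasGaussianLaw (Z n) P) (hZ0 : ∀ n, P[Z n] = 0)
    (hlim : ∀ᵐ ω ∂P, Tendsto (fun n => Z n ω) atTop (𝓝 (Y ω))) :
    HasGaussianLaw Y P ∧ P[Y] = 0 ∧
      Tendsto (fun n => Var[Z n; P]) atTop (𝓝 Var[Y; P]) := by
  have hP : IsProbabilityMeasure P := (hZ 0).isProbabilityMeasure
  have hY : AEMeasurable Y P := aemeasurable_of_tendsto_metrizable_ae atTop
    (fun n => (hZ n).aemeasurable) hlim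
  have hPY : IsProbabilityMeasure (P.map Y) := Measure.isProbabilityMeasure_map hY
  have hexp : ∀ u : ℝ, Tendsto (fun n => ((Real.exp (-(Var[Z n; P] * u ^ 2 / 2)) : ℝ) : ℂ)) atTop
      (𝓝 (charFun (P.map Y) u)) := by
    intro u
    have h1 : ∀ n, ((Real.exp (-(Var[Z n; P] * u ^ 2 / 2)) : ℝ) : ℂ) =
        ∫ ω, Complex.exp (u * Z n ω * Complex.I) ∂P := by
      intro n
      have h := charFun_apply_real (μ := P.map (Z n)) u
      rw [integral_map (hZ n).aemeasurable (by fun_prop), (hZ n).map_eq_gaussianReal,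
        charFun_gaussianReal, hZ0 n, Real.coe_toNNReal _ (variance_nonneg _ _)] at h
      rw [← h]
      push_cast
      simp
    simp_rw [h1]
    rw [charFun_apply_real, integral_map hY (by fun_prop)]
    refine tendsto_integral_of_dominated_convergence (fun _ => 1) (fun n => ?_) (by fun_prop)
      (fun n => ?_) ?_
    · have := (hZ n).aemeasurable
      exact (Measurable.comp_aemeasurable (g := fun x : ℝ => Complex.exp (u * x * Complex.I))
        (by fun_prop) this).aestronglyMeasurable
    · refine ae_of_all _ fun ω => ?_
      rw [← Complex.ofReal_mul, Complex.norm_exp_ofReal_mul_I]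
    · filter_upwards [hlim] with ω hω
      exact ((Continuous.tendsto (f := fun x : ℝ => Complex.exp (u * x * Complex.I))
        (by fun_prop) _).comp hω)
  -- The limiting characteristic function is continuous with value 1 at 0, so it is nonzero at some
  -- `u ≠ 0`; the logarithm of its modulus there determines the limit of the variances.
  obtain ⟨u, hu0, hu⟩ : ∃ u : ℝ, u ≠ 0 ∧ charFun (P.map Y) u ≠ 0 := by
    have hc : ContinuousAt (charFun (P.map Y)) 0 := continuous_charFun.continuousAt
    have h0 : charFun (P.map Y) 0 ≠ 0 := by simp
    have h1 : ∀ᶠ u in 𝓝[≠] (0 : ℝ), charFun (P.map Y) u ≠ 0 :=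
      (hc.eventually_ne h0).filter_mono nhdsWithin_le_nhds
    obtain ⟨u, h2, h3⟩ := (h1.and self_mem_nhdsWithin).exists
    exact ⟨u, h3, h2⟩
  set v : ℝ := -(Real.log ‖charFun (P.map Y) u‖) * 2 / u ^ 2
  have hv : Tendsto (fun n => Var[Z n; P]) atTop (𝓝 v) := by
    have h := (((hexp u).norm.log (norm_ne_zero_iff.2 hu)).neg.mul_const 2).div_const (u ^ 2)
    refine h.congr fun n => ?_
    rw [Complex.norm_real, Real.norm_of_nonneg (Real.exp_pos _).le, Real.log_exp]
    field_simp
  have hv0 : 0 ≤ v := ge_of_tendsto' hv fun n => variance_nonneg _ _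
  have hmap : P.map Y = gaussianReal 0 v.toNNReal := by
    refine Measure.ext_of_charFun (funext fun w => ?_)
    refine tendsto_nhds_unique (hexp w) ?_
    rw [charFun_gaussianReal, Real.coe_toNNReal _ hv0]
    have : Tendsto (fun n => Real.exp (-(Var[Z n; P] * w ^ 2 / 2))) atTop
        (𝓝 (Real.exp (-(v * w ^ 2 / 2)))) :=
      (Real.continuous_exp.tendsto _).comp (((hv.mul_const _).div_const _).neg)
    have e : Complex.exp (w * (0 : ℝ) * Complex.I - v * w ^ 2 / 2) =
        ((Real.exp (-(v * w ^ 2 / 2)) : ℝ) : ℂ) := by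
      push_cast
      simp
    rw [e]
    exact (Complex.continuous_ofReal.tendsto _).comp this
  have hG : HasGaussianLaw Y P := ⟨hmap ▸ inferInstance⟩
  refine ⟨hG, ?_, ?_⟩
  · have : ∫ x, x ∂(P.map Y) = 0 := by rw [hmap]; simp
    rwa [integral_map hY (by fun_prop)] at this
  · have : Var[id; P.map Y] = v := by
      rw [hmap, variance_id_gaussianReal, Real.coe_toNNReal _ hv0]
    rw [variance_map (by fun_prop) hY] at this
    rw [Function.id_comp] at this
    rwa [this]

/-- If `W` is centered and jointly Gaussian with `Z`, and `g` increases along the direction of the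
covariances of `W` with `Z`, then `g (Z)` and `W` are nonnegatively correlated. -/
lemma integral_mul_nonneg_of_hasGaussianLaw {Ω ι : Type*} [Finite ι] [MeasurableSpace Ω]
    {P : Measure Ω} {W : Ω → ℝ} {Z : ι → Ω → ℝ}
    (hWZ : HasGaussianLaw (fun ω => (W ω, fun i => Z i ω)) P) (hW0 : P[W] = 0)
    {g : (ι → ℝ) → ℝ} (hg : Measurable g) {C : ℝ} (hgC : ∀ z, |g z| ≤ C)
    (hmono : ∀ z, Monotone fun s : ℝ => g (z + s • fun i => cov[W, Z i; P])) :
    0 ≤ ∫ ω, g (fun i => Z i ω) * W ω ∂P := by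
  have := Fintype.ofFinite ι
  have hP : IsProbabilityMeasure P := hWZ.isProbabilityMeasure
  have hW : HasGaussianLaw W P := hWZ.fst
  have hZ : HasGaussianLaw (fun ω i => Z i ω) P := hWZ.snd
  have hZi : ∀ i, HasGaussianLaw (Z i) P := fun i => hZ.eval i
  have hVar : Var[W; P] = ∫ ω, W ω ^ 2 ∂P := variance_of_integral_eq_zero hW.aemeasurable hW0
  rcases eq_or_ne Var[W; P] 0 with h0 | h0
  · have : W =ᵐ[P] 0 := by
      rw [hVar, integral_eq_zero_iff_of_nonneg (fun _ => sq_nonneg _)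
        hW.memLp_two.integrable_sq] at h0
      filter_upwards [h0] with ω hω
      simpa using hω
    refine (integral_eq_zero_of_ae ?_).ge
    filter_upwards [this] with ω hω
    simp [hω]
  set v := Var[W; P] with hv
  have hvpos : 0 < v := lt_of_le_of_ne (variance_nonneg _ _) h0.symm
  set c : ι → ℝ := fun i => cov[W, Z i; P] with hc
  -- Regression on `W`: the residual `Z'` is uncorrelated with `W`, hence independent of it, and `g
  -- (Z') * W` has mean zero. Since `Z = Z' + (W / v) • c`, monotonicity of `g` along `c` gives `g
  -- (Z') * W ≤ g (Z) * W` pointwise, whatever the sign of `W`.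
  let Z' : ι → Ω → ℝ := fun i ω => Z i ω - c i / v * W ω
  let L : ℝ × (ι → ℝ) →L[ℝ] (Unit → ℝ) × (ι → ℝ) :=
    (ContinuousLinearMap.pi fun _ => .fst ℝ ℝ (ι → ℝ)).prod
      (ContinuousLinearMap.pi fun i => (ContinuousLinearMap.proj i).comp (.snd ℝ ℝ (ι → ℝ)) -
        (c i / v) • .fst ℝ ℝ (ι → ℝ))
  have hWZ' : HasGaussianLaw (fun ω => (fun _ : Unit => W ω, fun i => Z' i ω)) P := by
    exact hWZ.map L
  have hcov : ∀ (_ : Unit) (j : ι), cov[W, Z' j; P] = 0 := by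
    intro _ j
    have e : Z' j = fun ω => Z j ω - c j / v * W ω := rfl
    rw [e, covariance_fun_sub_right hW.memLp_two (hZi j).memLp_two
      (hW.memLp_two.const_mul _), covariance_const_mul_right, covariance_self hW.aemeasurable]
    change c j - c j / v * v = 0
    field_simp
    ring
  have hind := hWZ'.indepFun_of_covariance_eval (X := fun _ : Unit => W) (Y := Z') hcov
  have hZ'm : AEMeasurable (fun ω i => Z' i ω) P := hWZ'.snd.aemeasurable
  have hind' : (fun ω => g (fun i => Z' i ω)) ⟂ᵢ[P] W :=
    (hind.comp (φ := fun f : Unit → ℝ => f ()) (ψ := g) (measurable_pi_apply _) hg).symm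
  have hgm : ∀ {V : ι → Ω → ℝ}, AEMeasurable (fun ω i => V i ω) P →
      AEStronglyMeasurable (fun ω => g (fun i => V i ω)) P := fun h =>
    (hg.comp_aemeasurable h).aestronglyMeasurable
  have hz : ∫ ω, g (fun i => Z' i ω) * W ω ∂P = 0 := by
    rw [hind'.integral_fun_mul_eq_mul_integral (hgm hZ'm) hW.aemeasurable.aestronglyMeasurable,
      hW0, mul_zero]
  rw [← hz]
  have hint : ∀ {V : ι → Ω → ℝ}, AEMeasurable (fun ω i => V i ω) P →
      Integrable (fun ω => g (fun i => V i ω) * W ω) P := fun h =>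
    hW.integrable.bdd_mul (hgm h) (ae_of_all _ fun ω => hgC _)
  refine integral_mono (hint hZ'm) (hint hZ.aemeasurable) fun ω => ?_
  have e : (fun i => Z i ω) = (fun i => Z' i ω) + (W ω / v) • c := by
    ext i
    simp only [Z', Pi.add_apply, Pi.smul_apply, smul_eq_mul]
    ring
  have e0 : (fun i => Z' i ω) = (fun i => Z' i ω) + (0 : ℝ) • c := by simp
  change g (fun i => Z' i ω) * W ω ≤ g (fun i => Z i ω) * W ω
  rcases le_total 0 (W ω) with h | h
  · refine mul_le_mul_of_nonneg_right ?_ h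
    rw [e, e0, add_assoc, ← add_smul, zero_add]
    exact hmono _ (div_nonneg h hvpos.le)
  · refine mul_le_mul_of_nonpos_right ?_ h
    rw [e, e0, add_assoc, ← add_smul, zero_add]
    exact hmono _ (div_nonpos_of_nonpos_of_nonneg h hvpos.le)

/-! ### Slepian's inequality by rotating one Gaussian vector into another. -/

section Slepian

variable {ι : Type*}

/-- A rotation of two Gaussian vectors realized on a product space. -/
noncomputable def gaussianRotation (θ : ℝ) (i : ι) (ω : (ι → ℝ) × (ι → ℝ)) : ℝ :=
  Real.cos θ * ω.1 i + Real.sin θ * ω.2 i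

/-- The derivative of `gaussianRotation` in the angle. -/
noncomputable def gaussianRotationDeriv (θ : ℝ) (i : ι) (ω : (ι → ℝ) × (ι → ℝ)) : ℝ :=
  -Real.sin θ * ω.1 i + Real.cos θ * ω.2 i

lemma hasDerivAt_gaussianRotation (θ : ℝ) (i : ι) (ω : (ι → ℝ) × (ι → ℝ)) :
    HasDerivAt (fun θ => gaussianRotation θ i ω) (gaussianRotationDeriv θ i ω) θ :=
  ((Real.hasDerivAt_cos θ).mul_const _).add ((Real.hasDerivAt_sin θ).mul_const _)

@[fun_prop]
lemma measurable_gaussianRotation (θ : ℝ) (i : ι) : Measurable (gaussianRotation θ i) := by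
  unfold gaussianRotation
  fun_prop

@[fun_prop]
lemma measurable_gaussianRotationDeriv (θ : ℝ) (i : ι) :
    Measurable (gaussianRotationDeriv θ i) := by
  unfold gaussianRotationDeriv
  fun_prop

lemma memLp_eval_of_isGaussian (μ : Measure (ι → ℝ)) [IsGaussian μ] (i : ι) :
    MemLp (fun x : ι → ℝ => x i) 2 μ :=
  ((IsGaussian.hasGaussianLaw_id (μ := μ)).eval i).memLp_two

variable [Fintype ι] {μ ν : Measure (ι → ℝ)} [IsGaussian μ] [IsGaussian ν]

lemma hasGaussianLaw_gaussianRotation (θ : ℝ) (i : ι) :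
    HasGaussianLaw (fun ω => (gaussianRotationDeriv θ i ω, fun j => gaussianRotation θ j ω))
      (μ.prod ν) := by
  let L : (ι → ℝ) × (ι → ℝ) →L[ℝ] ℝ × (ι → ℝ) :=
    ((-Real.sin θ) • (ContinuousLinearMap.proj i).comp (.fst ℝ (ι → ℝ) (ι → ℝ)) +
      Real.cos θ • (ContinuousLinearMap.proj i).comp (.snd ℝ (ι → ℝ) (ι → ℝ))).prod
      (Real.cos θ • .fst ℝ (ι → ℝ) (ι → ℝ) + Real.sin θ • .snd ℝ (ι → ℝ) (ι → ℝ))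
  have h : HasGaussianLaw (id : (ι → ℝ) × (ι → ℝ) → _) (μ.prod ν) := IsGaussian.hasGaussianLaw_id
  exact h.map L

lemma integral_gaussianRotationDeriv (hμ : ∀ i, ∫ x, x i ∂μ = 0) (hν : ∀ i, ∫ x, x i ∂ν = 0)
    (θ : ℝ) (i : ι) : ∫ ω, gaussianRotationDeriv θ i ω ∂(μ.prod ν) = 0 := by
  have h1 := ((memLp_eval_of_isGaussian μ i).integrable one_le_two).comp_fst ν
  have h2 := ((memLp_eval_of_isGaussian ν i).integrable one_le_two).comp_snd μ
  unfold gaussianRotationDeriv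
  rw [integral_add (h1.const_mul _) (h2.const_mul _), integral_const_mul, integral_const_mul,
    integral_fun_fst (fun x : ι → ℝ => x i), integral_fun_snd (fun x : ι → ℝ => x i), hμ, hν]
  simp

/-- The factors are independent, so the mixed terms vanish. On `(0, π / 2)` the sign is that of the
difference of covariances, which drives the comparison. -/
lemma covariance_gaussianRotation (θ : ℝ) (i j : ι) :
    cov[gaussianRotationDeriv θ i, gaussianRotation θ j; μ.prod ν] =
      Real.sin θ * Real.cos θ *
        (cov[fun x => x i, fun x => x j; ν] - cov[fun x => x i, fun x => x j; μ]) := by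
  have hμ := fun i => (memLp_eval_of_isGaussian μ i).comp_fst ν
  have hν := fun i => (memLp_eval_of_isGaussian ν i).comp_snd μ
  have e1 : gaussianRotationDeriv (ι := ι) θ i =
    (fun ω => -Real.sin θ * ω.1 i) + fun ω => Real.cos θ * ω.2 i := rfl
  have e2 : gaussianRotation (ι := ι) θ j =
    (fun ω => Real.cos θ * ω.1 j) + fun ω => Real.sin θ * ω.2 j := rfl
  have c1 : cov[fun ω : (ι → ℝ) × (ι → ℝ) => ω.1 i, fun ω => ω.1 j; μ.prod ν] =
      cov[fun x => x i, fun x => x j; μ] := by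
    rw [← covariance_map_fun (Z := Prod.fst) (X := fun x : ι → ℝ => x i)
      (Y := fun x : ι → ℝ => x j) (measurable_pi_apply i).aestronglyMeasurable
      (measurable_pi_apply j).aestronglyMeasurable (by fun_prop), measurePreserving_fst.map_eq]
  have c2 : cov[fun ω : (ι → ℝ) × (ι → ℝ) => ω.2 i, fun ω => ω.2 j; μ.prod ν] =
      cov[fun x => x i, fun x => x j; ν] := by
    rw [← covariance_map_fun (Z := Prod.snd) (X := fun x : ι → ℝ => x i)
      (Y := fun x : ι → ℝ => x j) (measurable_pi_apply i).aestronglyMeasurable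
      (measurable_pi_apply j).aestronglyMeasurable (by fun_prop), measurePreserving_snd.map_eq]
  have c3 : cov[fun ω : (ι → ℝ) × (ι → ℝ) => ω.1 i, fun ω => ω.2 j; μ.prod ν] = 0 :=
    covariance_fst_snd_prod (memLp_eval_of_isGaussian μ i) (memLp_eval_of_isGaussian ν j)
  have c4 : cov[fun ω : (ι → ℝ) × (ι → ℝ) => ω.2 i, fun ω => ω.1 j; μ.prod ν] = 0 := by
    rw [covariance_comm]
    exact covariance_fst_snd_prod (memLp_eval_of_isGaussian μ j) (memLp_eval_of_isGaussian ν i)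
  rw [e1, e2, covariance_add_left ((hμ i).const_mul _) ((hν i).const_mul _)
      (((hμ j).const_mul _).add ((hν j).const_mul _)),
    covariance_add_right ((hμ i).const_mul _) ((hμ j).const_mul _) ((hν j).const_mul _),
    covariance_add_right ((hν i).const_mul _) ((hμ j).const_mul _) ((hν j).const_mul _)]
  simp only [covariance_const_mul_left, covariance_const_mul_right, c1, c2, c3, c4]
  ring

/-- **Slepian's inequality** for the expectation of a product of decreasing functions. -/
theorem integral_prod_comp_le_of_covariance_le
    (hμ : ∀ i, ∫ x, x i ∂μ = 0) (hν : ∀ i, ∫ x, x i ∂ν = 0)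
    (hvar : ∀ i, cov[fun x => x i, fun x => x i; μ] = cov[fun x => x i, fun x => x i; ν])
    (hcov : ∀ i j, cov[fun x => x i, fun x => x j; μ] ≤ cov[fun x => x i, fun x => x j; ν])
    {φ : ℝ → ℝ} (hφ : Differentiable ℝ φ) (hanti : Antitone φ) (hφ0 : ∀ x, 0 ≤ φ x)
    (hφ1 : ∀ x, φ x ≤ 1) {C : ℝ} (hC : ∀ x, |deriv φ x| ≤ C) :
    ∫ x, ∏ i, φ (x i) ∂μ ≤ ∫ x, ∏ i, φ (x i) ∂ν := by
  classical
  have hC0 : 0 ≤ C := (abs_nonneg _).trans (hC 0)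
  have hφm : Measurable φ := hφ.continuous.measurable
  have hφ'm : Measurable (deriv φ) := measurable_deriv φ
  have hprod0 : ∀ (s : Finset ι) (z : ι → ℝ), 0 ≤ ∏ j ∈ s, φ (z j) := fun s z =>
    Finset.prod_nonneg fun j _ => hφ0 _
  have hprod1 : ∀ (s : Finset ι) (z : ι → ℝ), ∏ j ∈ s, φ (z j) ≤ 1 := fun s z =>
    Finset.prod_le_one (fun j _ => hφ0 _) fun j _ => hφ1 _
  -- This is the partial derivative of the product in its `i`-th coordinate. Only one derivative of
  -- `φ` is used: the regression lemma replaces Gaussian integration by parts.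
  let g : ι → (ι → ℝ) → ℝ := fun i z => (∏ j ∈ Finset.univ.erase i, φ (z j)) * deriv φ (z i)
  have hgm : ∀ i, Measurable (g i) := by
    intro i
    refine Measurable.mul (Finset.measurable_fun_prod _ fun j _ => ?_) ?_
    · exact hφm.comp (measurable_pi_apply j)
    · exact hφ'm.comp (measurable_pi_apply i)
  have hgC : ∀ i z, |g i z| ≤ C := by
    intro i z
    simp only [g]
    rw [abs_mul, abs_of_nonneg (hprod0 _ _)]
    calc _ ≤ 1 * C := mul_le_mul (hprod1 _ _) (hC _) (abs_nonneg _) zero_le_one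
      _ = C := one_mul C
  let F : ℝ → (ι → ℝ) × (ι → ℝ) → ℝ := fun θ ω => ∏ i, φ (gaussianRotation θ i ω)
  let F' : ℝ → (ι → ℝ) × (ι → ℝ) → ℝ := fun θ ω =>
    ∑ i, g i (fun j => gaussianRotation θ j ω) * gaussianRotationDeriv θ i ω
  have hFm : ∀ θ, Measurable (F θ) := fun θ =>
    Finset.measurable_fun_prod _ fun j _ => hφm.comp (measurable_gaussianRotation θ j)
  have hgm' : ∀ θ i, Measurable fun ω => g i (fun j => gaussianRotation (ι := ι) θ j ω) :=
    fun θ i => (hgm i).comp (measurable_pi_lambda _ fun j => measurable_gaussianRotation θ j)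
  have hF'm : ∀ θ, Measurable (F' θ) := fun θ =>
    Finset.measurable_fun_sum _ fun i _ => (hgm' θ i).mul (measurable_gaussianRotationDeriv θ i)
  have hFd : ∀ θ ω, HasDerivAt (fun θ => F θ ω) (F' θ ω) θ := by
    intro θ ω
    have := HasDerivAt.fun_finsetProd (u := Finset.univ) (x := θ)
      (f := fun i θ => φ (gaussianRotation θ i ω)) fun i _ =>
        ((hφ _).hasDerivAt.comp θ (hasDerivAt_gaussianRotation θ i ω))
    refine this.congr_deriv ?_
    simp only [F', g, smul_eq_mul, mul_assoc]
  have hint : ∀ i, Integrable (fun ω : (ι → ℝ) × (ι → ℝ) => |ω.1 i| + |ω.2 i|) (μ.prod ν) :=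
    fun i => (((memLp_eval_of_isGaussian μ i).integrable one_le_two).comp_fst ν).abs.add
      (((memLp_eval_of_isGaussian ν i).integrable one_le_two).comp_snd μ).abs
  have hWle : ∀ θ i (ω : (ι → ℝ) × (ι → ℝ)), |gaussianRotationDeriv θ i ω| ≤ |ω.1 i| + |ω.2 i| := by
    intro θ i ω
    refine (abs_add_le _ _).trans ?_
    rw [abs_mul, abs_mul, abs_neg]
    exact add_le_add (mul_le_of_le_one_left (abs_nonneg _) (Real.abs_sin_le_one θ))
      (mul_le_of_le_one_left (abs_nonneg _) (Real.abs_cos_le_one θ))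
  have hderiv : ∀ θ, HasDerivAt (fun θ => ∫ ω, F θ ω ∂(μ.prod ν)) (∫ ω, F' θ ω ∂(μ.prod ν)) θ := by
    intro θ
    refine (hasDerivAt_integral_of_dominated_loc_of_deriv_le (s := Set.univ)
      (bound := fun ω => ∑ i, C * (|ω.1 i| + |ω.2 i|)) univ_mem
      (Eventually.of_forall fun θ => (hFm θ).aestronglyMeasurable) ?_
      (hF'm θ).aestronglyMeasurable (ae_of_all _ fun ω θ _ => ?_) ?_
      (ae_of_all _ fun ω θ _ => hFd θ ω)).2
    · refine Integrable.of_bound (hFm θ).aestronglyMeasurable 1 (ae_of_all _ fun ω => ?_)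
      rw [Real.norm_eq_abs, abs_of_nonneg (hprod0 _ _)]
      exact hprod1 _ _
    · refine (Finset.abs_sum_le_sum_abs _ _).trans (Finset.sum_le_sum fun i _ => ?_)
      rw [abs_mul]
      exact mul_le_mul (hgC _ _) (hWle _ _ _) (abs_nonneg _) hC0
    · exact integrable_finsetSum _ fun i _ => (hint i).const_mul C
  have hmono : MonotoneOn (fun θ => ∫ ω, F θ ω ∂(μ.prod ν)) (Icc 0 (Real.pi / 2)) := by
    refine monotoneOn_of_deriv_nonneg (convex_Icc _ _)
      (fun θ _ => (hderiv θ).continuousAt.continuousWithinAt)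
      (fun θ _ => (hderiv θ).differentiableAt.differentiableWithinAt) fun θ hθ => ?_
    rw [interior_Icc] at hθ
    rw [(hderiv θ).deriv, integral_finsetSum]
    · refine Finset.sum_nonneg fun i _ => ?_
      refine integral_mul_nonneg_of_hasGaussianLaw (hasGaussianLaw_gaussianRotation θ i)
        (integral_gaussianRotationDeriv hμ hν θ i) (hgm i) (hgC i) fun z s s' hs => ?_
      have hc0 : ∀ j, 0 ≤ cov[gaussianRotationDeriv θ i, gaussianRotation θ j; μ.prod ν] := by
        intro j
        rw [covariance_gaussianRotation]
        refine mul_nonneg (mul_nonneg ?_ ?_) (sub_nonneg.2 (hcov i j))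
        · exact (Real.sin_pos_of_pos_of_lt_pi hθ.1 (by linarith [hθ.2, Real.pi_pos])).le
        · exact (Real.cos_pos_of_mem_Ioo ⟨by linarith [hθ.1, Real.pi_pos], hθ.2⟩).le
      -- Equal variances freeze the `i`-th coordinate along the covariance direction, so the
      -- nonpositive factor `deriv φ (z i)` stays constant while the product of the others
      -- decreases.
      have hci : cov[gaussianRotationDeriv θ i, gaussianRotation θ i; μ.prod ν] = 0 := by
        rw [covariance_gaussianRotation, hvar, sub_self, mul_zero]
      simp only [g, Pi.add_apply, Pi.smul_apply, smul_eq_mul, hci, mul_zero]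
      refine mul_le_mul_of_nonpos_right ?_ hanti.deriv_nonpos
      refine Finset.prod_le_prod (fun j _ => hφ0 _) fun j _ => hanti ?_
      have := mul_le_mul_of_nonneg_right hs (hc0 j)
      linarith
    · intro i _
      refine ((hint i).const_mul C).mono'
        ((hgm' θ i).mul (measurable_gaussianRotationDeriv θ i)).aestronglyMeasurable
        (ae_of_all _ fun ω => ?_)
      rw [Real.norm_eq_abs, abs_mul]
      exact mul_le_mul (hgC _ _) (hWle _ _ _) (abs_nonneg _) hC0
  -- Angle `0` gives the law `μ`, angle `π / 2` the law `ν`.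
  have h := hmono (left_mem_Icc.2 (by positivity)) (right_mem_Icc.2 (by positivity))
    (show (0 : ℝ) ≤ Real.pi / 2 by positivity)
  simp only [F, gaussianRotation, Real.cos_zero, Real.sin_zero, Real.cos_pi_div_two,
    Real.sin_pi_div_two, one_mul, zero_mul, add_zero, zero_add] at h
  rwa [integral_fun_fst (fun x : ι → ℝ => ∏ i, φ (x i)),
    integral_fun_snd (fun x : ι → ℝ => ∏ i, φ (x i)), probReal_univ, probReal_univ, one_smul,
    one_smul] at h

/-- The shift `n` makes the limit 1 at `x = c` itself, so the closed half-line is obtained; the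
slope `n ^ 2` outweighs the shift when `x > c`. -/
lemma tendsto_sigmoid_step (c x : ℝ) :
    Tendsto (fun n : ℕ => Real.sigmoid (n - n ^ 2 * (x - c))) atTop
      (𝓝 (if x ≤ c then 1 else 0)) := by
  split_ifs with h
  · refine Real.tendsto_sigmoid_atTop.comp ?_
    refine tendsto_atTop_mono (fun n => ?_) tendsto_natCast_atTop_atTop
    nlinarith [mul_nonneg (sq_nonneg (n : ℝ)) (sub_nonneg.2 h)]
  · have hx : 0 < x - c := by linarith [not_le.1 h]
    refine Real.tendsto_sigmoid_atBot.comp ?_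
    have h1 : Tendsto (fun n : ℕ => (n : ℝ) * (1 - n * (x - c))) atTop atBot := by
      refine tendsto_natCast_atTop_atTop.atTop_mul_atBot₀ ?_
      exact tendsto_atBot_add_const_left _ 1
        (tendsto_neg_atTop_atBot.comp (tendsto_natCast_atTop_atTop.atTop_mul_const hx))
    refine h1.congr fun n => ?_
    ring

lemma tendsto_integral_prod_sigmoid (μ : Measure (ι → ℝ)) [IsProbabilityMeasure μ] (c : ℝ) :
    Tendsto (fun n : ℕ => ∫ x, ∏ i, Real.sigmoid (n - n ^ 2 * (x i - c)) ∂μ) atTop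
      (𝓝 (μ.real {x | ∀ i, x i ≤ c})) := by
  have hm : MeasurableSet {x : ι → ℝ | ∀ i, x i ≤ c} := by
    simp only [Set.ofPred_forall]
    exact MeasurableSet.iInter fun i => measurableSet_le (measurable_pi_apply i) measurable_const
  rw [← integral_indicator_one hm]
  refine tendsto_integral_of_dominated_convergence (fun _ => 1) (fun n => ?_) (by fun_prop)
    (fun n => ae_of_all _ fun x => ?_) (ae_of_all _ fun x => ?_)
  · have : Continuous Real.sigmoid := continuous_sigmoid
    exact Continuous.aestronglyMeasurable (by fun_prop)
  · rw [Real.norm_eq_abs, abs_of_nonneg (Finset.prod_nonneg fun i _ => Real.sigmoid_nonneg _)]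
    exact Finset.prod_le_one (fun i _ => Real.sigmoid_nonneg _) fun i _ => Real.sigmoid_le_one _
  · have h := tendsto_finsetProd (Finset.univ : Finset ι) fun i _ => tendsto_sigmoid_step c (x i)
    convert h using 2
    rw [Finset.prod_ite_zero]
    simp [indicator_apply]

/-- **Slepian's inequality**. -/
theorem measureReal_forall_le_le_of_covariance_le
    (hμ : ∀ i, ∫ x, x i ∂μ = 0) (hν : ∀ i, ∫ x, x i ∂ν = 0)
    (hvar : ∀ i, cov[fun x => x i, fun x => x i; μ] = cov[fun x => x i, fun x => x i; ν])
    (hcov : ∀ i j, cov[fun x => x i, fun x => x j; μ] ≤ cov[fun x => x i, fun x => x j; ν])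
    (c : ℝ) : μ.real {x | ∀ i, x i ≤ c} ≤ ν.real {x | ∀ i, x i ≤ c} := by
  refine le_of_tendsto_of_tendsto' (tendsto_integral_prod_sigmoid μ c)
    (tendsto_integral_prod_sigmoid ν c) fun n => ?_
  have hd : ∀ x : ℝ, HasDerivAt (fun x : ℝ => Real.sigmoid (n - n ^ 2 * (x - c)))
      (Real.sigmoid (n - n ^ 2 * (x - c)) * (1 - Real.sigmoid (n - n ^ 2 * (x - c))) *
        -((n : ℝ) ^ 2 * 1)) x := fun x =>
    (Real.hasDerivAt_sigmoid _).comp x ((((hasDerivAt_id x).sub_const c).const_mul _).const_sub _)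
  refine integral_prod_comp_le_of_covariance_le hμ hν hvar hcov
    (φ := fun x => Real.sigmoid (n - n ^ 2 * (x - c))) (fun x => (hd x).differentiableAt)
    (fun x y h => Real.sigmoid_le ?_) (fun _ => Real.sigmoid_nonneg _)
    (fun _ => Real.sigmoid_le_one _) (C := (n : ℝ) ^ 2) fun x => ?_
  · have := mul_le_mul_of_nonneg_left h (sq_nonneg (n : ℝ))
    linarith
  · rw [(hd x).deriv, abs_mul, abs_neg, mul_one, abs_of_nonneg (sq_nonneg (n : ℝ))]
    refine mul_le_of_le_one_left (sq_nonneg _) ?_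
    have h0 := Real.sigmoid_nonneg (n - n ^ 2 * (x - c))
    have h1 := Real.sigmoid_le_one (n - n ^ 2 * (x - c))
    rw [abs_of_nonneg (mul_nonneg h0 (by linarith))]
    exact mul_le_one₀ h1 (by linarith) (by linarith)

end Slepian

/-! ### Riemann sums of continuous paths. -/

/-- The left Riemann sum of `f` over `[0, t]` with `n` subdivisions. -/
noncomputable def leftRiemannSum (f : ℝ → ℝ) (n : ℕ) (t : ℝ) : ℝ :=
  t / n * ∑ k ∈ Finset.range n, f (t * (k / n))

lemma tendsto_leftRiemannSum_one {f : ℝ → ℝ} (hf : Continuous f) :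
    Tendsto (fun n : ℕ => leftRiemannSum f n 1) atTop (𝓝 (∫ x in (0 : ℝ)..1, f x)) := by
  rw [Metric.tendsto_atTop]
  intro ε hε
  have huc := isCompact_Icc.uniformContinuousOn_of_continuous
    (hf.continuousOn (s := Icc (0 : ℝ) 1))
  rw [Metric.uniformContinuousOn_iff] at huc
  obtain ⟨δ, hδ, h⟩ := huc (ε / 2) (by positivity)
  obtain ⟨N, hN⟩ := exists_nat_gt (1 / δ)
  refine ⟨N, fun n hn => ?_⟩
  have hnpos : 0 < (n : ℝ) := (by positivity : 0 < 1 / δ).trans (hN.trans_le (by exact_mod_cast hn))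
  have hnδ : 1 / (n : ℝ) < δ := by
    rw [div_lt_comm₀ hnpos hδ]
    exact hN.trans_le (by exact_mod_cast hn)
  have hsum := intervalIntegral.sum_integral_adjacent_intervals (f := f) (μ := volume)
    (a := fun k : ℕ => (k : ℝ) / n) (n := n) fun k _ => hf.intervalIntegrable _ _
  simp only [Nat.cast_zero, zero_div, div_self hnpos.ne'] at hsum
  rw [← hsum, leftRiemannSum, Finset.mul_sum, Real.dist_eq, ← Finset.sum_sub_distrib]
  refine (Finset.abs_sum_le_sum_abs _ _).trans_lt ?_
  refine (Finset.sum_le_sum (g := fun _ => ε / 2 * (1 / n)) fun k hk => ?_).trans_lt ?_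
  · have hk' : (k : ℝ) + 1 ≤ n := by exact_mod_cast Finset.mem_range.1 hk
    have hlen : ((k + 1 : ℕ) : ℝ) / n - k / n = 1 / n := by push_cast; ring
    have hle : (k : ℝ) / n ≤ ((k + 1 : ℕ) : ℝ) / n := by
      rw [← sub_nonneg, hlen]; positivity
    have hconst : 1 / (n : ℝ) * f (1 * (k / n)) =
        ∫ _ in (k : ℝ) / n..((k + 1 : ℕ) : ℝ) / n, f (k / n) := by
      rw [intervalIntegral.integral_const, hlen, one_mul, smul_eq_mul]
    rw [hconst, ← intervalIntegral.integral_sub (by simp) (hf.intervalIntegrable _ _),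
      ← Real.norm_eq_abs]
    refine (intervalIntegral.norm_integral_le_of_norm_le_const (C := ε / 2) fun x hx => ?_).trans ?_
    · rw [uIoc_of_le hle] at hx
      have h1 : ((k + 1 : ℕ) : ℝ) / n ≤ 1 := by
        rw [div_le_one hnpos]; exact_mod_cast Finset.mem_range.1 hk
      have h0 : 0 ≤ (k : ℝ) / n := by positivity
      refine (h _ ⟨h0, hle.trans h1⟩ _ ⟨h0.trans hx.1.le, hx.2.trans h1⟩ ?_).le
      rw [dist_comm, Real.dist_eq, abs_of_nonneg (by linarith [hx.1])]
      linarith [hx.2]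
    · rw [hlen, abs_of_nonneg (by positivity)]
  · rw [Finset.sum_const, Finset.card_range, nsmul_eq_mul]
    field_simp
    linarith

lemma tendsto_leftRiemannSum {f : ℝ → ℝ} (hf : Continuous f) (t : ℝ) :
    Tendsto (fun n : ℕ => leftRiemannSum f n t) atTop (𝓝 (∫ x in (0 : ℝ)..t, f x)) := by
  have h := (tendsto_leftRiemannSum_one (f := fun x => f (t * x)) (by fun_prop)).const_mul t
  rw [intervalIntegral.mul_integral_comp_mul_left, mul_zero, mul_one] at h
  refine h.congr fun n => ?_
  simp only [leftRiemannSum, one_mul]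
  ring

/-! ### Closed form of the covariance of the integrated process. -/

/-- The covariance function of a fractional Brownian motion. -/
noncomputable def fbmCovariance (H u v : ℝ) : ℝ :=
  (|u| ^ (2 * H) + |v| ^ (2 * H) - |u - v| ^ (2 * H)) / 2

lemma continuous_fbmCovariance {H : ℝ} (hH : 0 < H) :
    Continuous fun q : ℝ × ℝ => fbmCovariance H q.1 q.2 := by
  have h : 0 ≤ 2 * H := by positivity
  unfold fbmCovariance
  exact ((((continuous_fst.abs.rpow_const fun _ => Or.inr h)).add
    (continuous_snd.abs.rpow_const fun _ => Or.inr h)).sub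
    ((continuous_fst.sub continuous_snd).abs.rpow_const fun _ => Or.inr h)).div_const _

lemma integral_fbmCovariance {H u s : ℝ} (hH : 0 < H) (hu : 0 ≤ u) (hus : u ≤ s) :
    ∫ v in (0 : ℝ)..s, fbmCovariance H u v =
      (s * u ^ (2 * H) + s ^ (2 * H + 1) / (2 * H + 1) -
        (u ^ (2 * H + 1) + (s - u) ^ (2 * H + 1)) / (2 * H + 1)) / 2 := by
  have hh : -1 < 2 * H := by linarith
  have hh1 : 2 * H + 1 ≠ 0 := by positivity
  have hc : Continuous fun v : ℝ => |v| ^ (2 * H) :=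
    continuous_abs.rpow_const fun _ => Or.inr (by positivity)
  have hc' : Continuous fun v : ℝ => |u - v| ^ (2 * H) := hc.comp (continuous_const.sub continuous_id)
  have i1 : ∫ v in (0 : ℝ)..s, |v| ^ (2 * H) = s ^ (2 * H + 1) / (2 * H + 1) := by
    rw [intervalIntegral.integral_congr (g := fun v => v ^ (2 * H)), integral_rpow (Or.inl hh),
      Real.zero_rpow hh1, sub_zero]
    intro v hv
    rw [uIcc_of_le (hu.trans hus)] at hv
    simp only [abs_of_nonneg hv.1]
  have i2 : ∫ v in (0 : ℝ)..u, |u - v| ^ (2 * H) = u ^ (2 * H + 1) / (2 * H + 1) := by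
    rw [intervalIntegral.integral_congr (g := fun v => (u - v) ^ (2 * H)),
      intervalIntegral.integral_comp_sub_left (fun v => v ^ (2 * H)), integral_rpow (Or.inl hh)]
    · simp [Real.zero_rpow hh1]
    · intro v hv
      rw [uIcc_of_le hu] at hv
      simp only [abs_of_nonneg (sub_nonneg.2 hv.2)]
  have i3 : ∫ v in u..s, |u - v| ^ (2 * H) = (s - u) ^ (2 * H + 1) / (2 * H + 1) := by
    rw [intervalIntegral.integral_congr (g := fun v => (v - u) ^ (2 * H)),
      intervalIntegral.integral_comp_sub_right (fun v => v ^ (2 * H)), integral_rpow (Or.inl hh)]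
    · simp [Real.zero_rpow hh1]
    · intro v hv
      rw [uIcc_of_le hus] at hv
      simp only [abs_sub_comm u v, abs_of_nonneg (sub_nonneg.2 hv.1)]
  -- The integral is split at `v = u`, where the absolute value changes branch.
  have i4 : ∫ v in (0 : ℝ)..s, |u - v| ^ (2 * H) =
      (u ^ (2 * H + 1) + (s - u) ^ (2 * H + 1)) / (2 * H + 1) := by
    rw [← intervalIntegral.integral_add_adjacent_intervals (hc'.intervalIntegrable 0 u)
      (hc'.intervalIntegrable u s), i2, i3, add_div]
  have hc'' : Continuous fun v : ℝ => |u| ^ (2 * H) + |v| ^ (2 * H) := continuous_const.add hc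
  unfold fbmCovariance
  rw [intervalIntegral.integral_div, intervalIntegral.integral_sub
    (hc''.intervalIntegrable _ _) (hc'.intervalIntegrable _ _),
    intervalIntegral.integral_add (by simp) (hc.intervalIntegrable _ _), i1, i4,
    intervalIntegral.integral_const, abs_of_nonneg hu]
  simp

lemma integral_integral_fbmCovariance {H t s : ℝ} (hH : 0 < H) (ht : 0 ≤ t) (hts : t ≤ s) :
    ∫ u in (0 : ℝ)..t, ∫ v in (0 : ℝ)..s, fbmCovariance H u v =
      ((s * t ^ (2 * H + 1) + t * s ^ (2 * H + 1)) / (2 * H + 1) -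
        (t ^ (2 * H + 2) + s ^ (2 * H + 2) - (s - t) ^ (2 * H + 2)) /
          ((2 * H + 1) * (2 * H + 2))) / 2 := by
  have hh : -1 < 2 * H := by linarith
  have hh' : -1 < 2 * H + 1 := by linarith
  have hh1 : 2 * H + 1 ≠ 0 := by positivity
  have hh2 : 2 * H + 1 + 1 ≠ 0 := by positivity
  have c1 : Continuous fun v : ℝ => v ^ (2 * H) :=
    continuous_id.rpow_const fun _ => Or.inr (by positivity)
  have c2 : Continuous fun v : ℝ => v ^ (2 * H + 1) :=
    continuous_id.rpow_const fun _ => Or.inr (by positivity)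
  have c3 : Continuous fun v : ℝ => (s - v) ^ (2 * H + 1) :=
    c2.comp (continuous_const.sub continuous_id)
  have c4 : Continuous fun v : ℝ => s * v ^ (2 * H) := continuous_const.mul c1
  have c5 : Continuous fun v : ℝ => s * v ^ (2 * H) + s ^ (2 * H + 1) / (2 * H + 1) :=
    c4.add continuous_const
  have c6 : Continuous fun v : ℝ => (v ^ (2 * H + 1) + (s - v) ^ (2 * H + 1)) / (2 * H + 1) :=
    (c2.add c3).div_const _
  rw [intervalIntegral.integral_congr (g := fun u =>
    (s * u ^ (2 * H) + s ^ (2 * H + 1) / (2 * H + 1) -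
        (u ^ (2 * H + 1) + (s - u) ^ (2 * H + 1)) / (2 * H + 1)) / 2)]
  · rw [intervalIntegral.integral_div, intervalIntegral.integral_sub
        (c5.intervalIntegrable _ _) (c6.intervalIntegrable _ _),
      intervalIntegral.integral_add (c4.intervalIntegrable _ _) (by simp),
      intervalIntegral.integral_const_mul, integral_rpow (Or.inl hh),
      intervalIntegral.integral_const, intervalIntegral.integral_div,
      intervalIntegral.integral_add (c2.intervalIntegrable _ _) (c3.intervalIntegrable _ _),
      integral_rpow (Or.inl hh'),
      intervalIntegral.integral_comp_sub_left (fun v => v ^ (2 * H + 1)),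
      integral_rpow (Or.inl hh'), Real.zero_rpow hh1, Real.zero_rpow hh2, smul_eq_mul,
      show 2 * H + 2 = 2 * H + 1 + 1 by ring]
    simp only [sub_zero]
    field_simp
    ring
  · intro u hu
    rw [uIcc_of_le ht] at hu
    exact integral_fbmCovariance hH hu.1 (hu.2.trans hts)

/-- Self-similarity: with `T = τ ^ (1 / (1 + H))` the two times are `x * T` and `T`, and `T ^ (2 * H
+ 2) = τ ^ 2` factors out of the closed form, leaving a function of `σ / τ`. -/
lemma fbm_covariance_timeChange_eq {H σ τ : ℝ} (hH : 0 < H) (hσ : 0 < σ) (hστ : σ ≤ τ) :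
    (2 * H + 2) * ∫ u in (0 : ℝ)..σ ^ (1 / (1 + H)), ∫ v in (0 : ℝ)..τ ^ (1 / (1 + H)),
      fbmCovariance H u v = τ ^ 2 * integratedCovariance (σ / τ) (1 + H) := by
  have hτ : 0 < τ := hσ.trans_le hστ
  have hp : 0 < 1 + H := by linarith
  set T := τ ^ (1 / (1 + H)) with hT
  set x := (σ / τ) ^ (1 / (1 + H)) with hx
  have hT0 : 0 < T := Real.rpow_pos_of_pos hτ _
  have hx0 : 0 < x := Real.rpow_pos_of_pos (div_pos hσ hτ) _
  have hx1 : x ≤ 1 := Real.rpow_le_one (div_pos hσ hτ).le ((div_le_one hτ).2 hστ) (by positivity)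
  have hσ' : σ ^ (1 / (1 + H)) = x * T := by
    rw [hx, Real.div_rpow hσ.le hτ.le, div_mul_cancel₀ _ hT0.ne']
  have hTτ : T ^ (2 * H + 2) = τ ^ 2 := by
    rw [hT, ← Real.rpow_mul hτ.le, ← Real.rpow_natCast]
    congr 1
    field_simp
    push_cast
    ring
  have hxσ : x ^ (2 * H + 2) = (σ / τ) ^ 2 := by
    rw [hx, ← Real.rpow_mul (div_pos hσ hτ).le, ← Real.rpow_natCast]
    congr 1
    field_simp
    push_cast
    ring
  have e1 : ∀ z : ℝ, 0 < z → z ^ (2 * H + 1) = z ^ (2 * H + 2) / z := by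
    intro z hz
    rw [eq_div_iff hz.ne', ← Real.rpow_add_one hz.ne']
    ring_nf
  have e2 : (T - x * T) ^ (2 * H + 2) = (1 - x) ^ (2 * H + 2) * τ ^ 2 := by
    rw [show T - x * T = (1 - x) * T by ring, Real.mul_rpow (by linarith) hT0.le, hTτ]
  rw [hσ', integral_integral_fbmCovariance hH (by positivity) (mul_le_of_le_one_left hT0.le hx1),
    e2, e1 _ hT0, e1 _ (mul_pos hx0 hT0), Real.mul_rpow hx0.le hT0.le, hTτ, hxσ,
    integratedCovariance, ← hx, show 2 * (1 + H) = 2 * H + 2 by ring,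
    show 2 * H + 2 - 1 = 2 * H + 1 by ring]
  have h3 : 2 * H + 1 ≠ 0 := by positivity
  have h4 : 2 * H + 2 ≠ 0 := by positivity
  field_simp
  ring

lemma integratedCovariance_one {p : ℝ} (hp : 1 / 2 < p) : integratedCovariance 1 p = 1 := by
  have h1 : 2 * p - 1 ≠ 0 := by linarith
  have h2 : 2 * p ≠ 0 := by linarith
  simp only [integratedCovariance, Real.one_rpow, sub_self, Real.zero_rpow h2]
  field_simp
  ring

lemma integratedCovariance_le {a H₀ H : ℝ} (ha0 : 0 < a) (ha1 : a ≤ 1) (h0 : 1 / 2 < H₀)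
    (h : H₀ ≤ H) (h1 : H < 1) :
    integratedCovariance a (1 + H₀) ≤ integratedCovariance a (1 + H) := by
  rcases ha1.eq_or_lt with rfl | ha1
  · rw [integratedCovariance_one (by linarith), integratedCovariance_one (by linarith)]
  · exact monotoneOn_integratedCovariance ha0 ha1 ⟨by linarith, by linarith⟩
      ⟨by linarith, by linarith⟩ (by linarith)

/-! ### Gaussianity and covariance of the integrated process. -/

section GaussianLimit

variable {Ω : Type*} [MeasurableSpace Ω] {P : Measure Ω}

/-- The Cramér–Wold device, which reduces joint limits to limits of real variables. -/
lemma hasGaussianLaw_pi_of_forall {ι : Type*} [Finite ι] {X : ι → Ω → ℝ} (hX : ∀ i, AEMeasurable (X i) P)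
    (h : ∀ L : StrongDual ℝ (ι → ℝ), HasGaussianLaw (fun ω => L fun i => X i ω) P) :
    HasGaussianLaw (fun ω i => X i ω) P where
  isGaussian_map := by
    have := Fintype.ofFinite ι
    refine isGaussian_of_isGaussian_map fun L => ?_
    rw [AEMeasurable.map_map_of_aemeasurable (by fun_prop) (aemeasurable_pi_lambda _ hX)]
    exact (h L).isGaussian_map

lemma covariance_eq_variance_add_sub_variance_sub [IsFiniteMeasure P] {X Y : Ω → ℝ}
    (hX : MemLp X 2 P) (hY : MemLp Y 2 P) :
    cov[X, Y; P] = (Var[X + Y; P] - Var[X - Y; P]) / 4 := by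
  rw [variance_add hX hY, variance_sub hX hY]
  ring

/-- An almost sure limit of centered Gaussian processes is a centered Gaussian process, and the
covariances converge. -/
theorem isGaussianProcess_of_tendsto_ae {T : Type*} {X : ℕ → T → Ω → ℝ} {Y : T → Ω → ℝ}
    (hX : ∀ n, IsGaussianProcess (X n) P) (hX0 : ∀ n t, P[X n t] = 0)
    (hlim : ∀ t, ∀ᵐ ω ∂P, Tendsto (fun n => X n t ω) atTop (𝓝 (Y t ω))) :
    IsGaussianProcess Y P ∧ (∀ t, P[Y t] = 0) ∧
      ∀ s t, Tendsto (fun n => cov[X n s, X n t; P]) atTop (𝓝 cov[Y s, Y t; P]) := by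
  have hP : IsProbabilityMeasure P := (hX 0).isProbabilityMeasure
  have hint : ∀ n t, Integrable (X n t) P := fun n t => ((hX n).hasGaussianLaw_eval t).integrable
  have hYg : ∀ t, HasGaussianLaw (Y t) P ∧ P[Y t] = 0 ∧ _ := fun t =>
    hasGaussianLaw_of_tendsto_ae (fun n => (hX n).hasGaussianLaw_eval t) (fun n => hX0 n t) (hlim t)
  refine ⟨⟨fun I => ?_⟩, fun t => (hYg t).2.1, fun s t => ?_⟩
  · refine hasGaussianLaw_pi_of_forall (X := fun (i : I) ω => Y i ω) (fun i => (hYg i).1.aemeasurable)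
      fun L => ?_
    refine (hasGaussianLaw_of_tendsto_ae (Z := fun n ω => L (I.restrict fun t => X n t ω))
      (fun n => ((hX n).hasGaussianLaw I).map_fun L) (fun n => ?_) ?_).1
    · rw [L.integral_comp_comm ((hX n).hasGaussianLaw I).integrable]
      have : ∫ ω, (I.restrict fun t => X n t ω) ∂P = 0 := by
        ext i
        exact (eval_integral (f := fun (ω : Ω) (i : I) => X n i ω) (fun i : I => hint n i) i).trans
          (hX0 n i)
      rw [this, map_zero]
    · have h : ∀ᵐ ω ∂P, ∀ i : I, Tendsto (fun n => X n i ω) atTop (𝓝 (Y i ω)) :=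
        ae_all_iff.2 fun i => hlim i
      filter_upwards [h] with ω hω
      exact (L.continuous.tendsto _).comp (tendsto_pi_nhds.2 hω)
  -- Only variances are known to converge, so covariances are recovered by polarization from sums
  -- and differences.
  · have h1 := (hasGaussianLaw_of_tendsto_ae (Z := fun n => X n s + X n t) (Y := Y s + Y t)
      (fun n => (hX n).hasGaussianLaw_add) (fun n => by
        rw [integral_add' (hint n s) (hint n t), hX0, hX0, add_zero]) (by
        filter_upwards [hlim s, hlim t] with ω hs ht using hs.add ht)).2.2
    have h2 := (hasGaussianLaw_of_tendsto_ae (Z := fun n => X n s - X n t) (Y := Y s - Y t)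
      (fun n => (hX n).hasGaussianLaw_sub) (fun n => by
        rw [integral_sub' (hint n s) (hint n t), hX0, hX0, sub_zero]) (by
        filter_upwards [hlim s, hlim t] with ω hs ht using hs.sub ht)).2.2
    rw [covariance_eq_variance_add_sub_variance_sub (hYg s).1.memLp_two (hYg t).1.memLp_two]
    refine ((h1.sub h2).div_const 4).congr fun n => ?_
    rw [covariance_eq_variance_add_sub_variance_sub ((hX n).hasGaussianLaw_eval s).memLp_two
      ((hX n).hasGaussianLaw_eval t).memLp_two]

/-- The index-dependent finite set, factor and times let one family mix Riemann sums with untouched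
variables, the latter being one-term sums with factor 1. -/
lemma isGaussianProcess_mul_sum {S T : Type*} {X : T → Ω → ℝ} (hX : IsGaussianProcess X P)
    (F : S → Finset ℕ) (c : S → ℝ) (e : S → ℕ → T) :
    IsGaussianProcess (fun s ω => c s * ∑ k ∈ F s, X (e s k) ω) P := by
  classical
  refine hX.of_isGaussianProcess fun s => ⟨(F s).image (e s),
    c s • ∑ k : F s, ContinuousLinearMap.proj
      (⟨e s k, Finset.mem_image_of_mem _ k.2⟩ : (F s).image (e s)), fun ω => ?_⟩
  simp only [smul_apply, sum_apply,
    ContinuousLinearMap.proj_apply, Finset.restrict, smul_eq_mul]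
  rw [← Finset.sum_coe_sort]

variable {H : ℝ} {b : ℝ → Ω → ℝ}

lemma IsFractionalBrownianMotion.covariance_eq (hb : IsFractionalBrownianMotion H b P)
    (u v : ℝ) : cov[b u, b v; P] = fbmCovariance H u v := by
  have hg := hb.isGaussianProcess
  have hP : IsProbabilityMeasure P := hg.isProbabilityMeasure
  have hL : ∀ x, MemLp (b x) 2 P := fun x => (hg.hasGaussianLaw_eval x).memLp_two
  have hsq : ∀ x, ∫ ω, b x ω ^ 2 ∂P = |x| ^ (2 * H) := by
    intro x
    rw [← sub_zero x, ← hb.structure_function x 0, sub_zero]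
    refine integral_congr_ae ?_
    filter_upwards [hb.start_zero] with ω hω
    rw [hω, sub_zero]
  have h := hb.structure_function u v
  have e : ∀ ω, (b u ω - b v ω) ^ 2 = b u ω ^ 2 + b v ω ^ 2 - 2 * (b u ω * b v ω) := fun ω => by ring
  simp_rw [e] at h
  have i1 : Integrable (fun ω => b u ω ^ 2 + b v ω ^ 2) P :=
    (hL u).integrable_sq.add (hL v).integrable_sq
  have i2 : Integrable (fun ω => 2 * (b u ω * b v ω)) P :=
    ((hL u).integrable_mul (hL v)).const_mul 2
  rw [integral_sub i1 i2, integral_add (hL u).integrable_sq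
    (hL v).integrable_sq, hsq, hsq, integral_const_mul] at h
  rw [covariance_eq_sub (hL u) (hL v), hb.mean_zero, zero_mul, sub_zero, fbmCovariance]
  simp only [Pi.mul_apply]
  linarith

lemma IsFractionalBrownianMotion.tendsto_leftRiemannSum_ae
    (hb : IsFractionalBrownianMotion H b P) (t : ℝ) :
    ∀ᵐ ω ∂P, Tendsto (fun n : ℕ => leftRiemannSum (fun s => b s ω) n t) atTop
      (𝓝 (∫ s in (0 : ℝ)..t, b s ω)) := by
  filter_upwards [hb.continuous_paths] with ω hω using tendsto_leftRiemannSum hω t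

lemma integral_leftRiemannSum_eq_zero {b : ℝ → Ω → ℝ} (hi : ∀ x, Integrable (b x) P)
    (h0 : ∀ x, P[b x] = 0) (n : ℕ) (t : ℝ) :
    ∫ ω, leftRiemannSum (fun s => b s ω) n t ∂P = 0 := by
  unfold leftRiemannSum
  rw [integral_const_mul, integral_finsetSum _ fun k _ => hi _]
  simp [h0]

lemma covariance_leftRiemannSum_right [IsFiniteMeasure P] {X : Ω → ℝ} {b : ℝ → Ω → ℝ}
    (hX : MemLp X 2 P) (hL : ∀ x, MemLp (b x) 2 P) (n : ℕ) (t : ℝ) :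
    cov[X, fun ω => leftRiemannSum (fun s => b s ω) n t; P] =
      leftRiemannSum (fun s => cov[X, b s; P]) n t := by
  unfold leftRiemannSum
  rw [covariance_const_mul_right, covariance_fun_sum_right' (fun k _ => hL _) hX]

/-- The integral of a fractional Brownian motion is jointly Gaussian with it. -/
lemma IsFractionalBrownianMotion.isGaussianProcess_integral
    (hb : IsFractionalBrownianMotion H b P) :
    IsGaussianProcess (Sum.elim b fun t ω => ∫ s in (0 : ℝ)..t, b s ω) P ∧
      (∀ t, ∫ ω, (∫ s in (0 : ℝ)..t, b s ω) ∂P = 0) ∧ (0 < H → ∀ u t,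
        cov[b u, fun ω => ∫ s in (0 : ℝ)..t, b s ω; P] =
          ∫ v in (0 : ℝ)..t, fbmCovariance H u v) := by
  have hg := hb.isGaussianProcess
  have hP : IsProbabilityMeasure P := hg.isProbabilityMeasure
  have hL : ∀ x, MemLp (b x) 2 P := fun x => (hg.hasGaussianLaw_eval x).memLp_two
  -- The left summand keeps `b` itself, so that the limit also yields the covariance of `b u` with
  -- the integral.
  have h := isGaussianProcess_of_tendsto_ae (P := P)
    (X := fun n => Sum.elim b fun t ω => leftRiemannSum (fun s => b s ω) n t)
    (Y := Sum.elim b fun t ω => ∫ s in (0 : ℝ)..t, b s ω) ?_ ?_ ?_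
  · refine ⟨h.1, fun t => h.2.1 (Sum.inr t), fun hH u t => ?_⟩
    refine tendsto_nhds_unique (h.2.2 (Sum.inl u) (Sum.inr t)) ?_
    simp only [Sum.elim_inl, Sum.elim_inr]
    simp_rw [covariance_leftRiemannSum_right (hL u) hL, hb.covariance_eq]
    exact tendsto_leftRiemannSum
      ((continuous_fbmCovariance hH).comp (Continuous.prodMk_right u)) t
  · intro n
    convert! isGaussianProcess_mul_sum hg (S := ℝ ⊕ ℝ)
      (Sum.elim (fun _ => {0}) fun _ => Finset.range n) (Sum.elim (fun _ => 1) fun t => t / n)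
      (Sum.elim (fun u _ => u) fun t k => t * (k / n)) using 1
    ext (u | t) ω
    · simp
    · simp [leftRiemannSum]
  · rintro n (u | t)
    · exact hb.mean_zero u
    · exact integral_leftRiemannSum_eq_zero (fun x => (hL x).integrable one_le_two) hb.mean_zero n t
  · rintro (u | t)
    · exact ae_of_all _ fun ω => tendsto_const_nhds
    · exact hb.tendsto_leftRiemannSum_ae t

/-- A second passage to the limit: only one of the two integrals is discretized, and its covariance
with the other is already known, so a single Riemann sum converges to the iterated integral. -/
lemma IsFractionalBrownianMotion.covariance_integral (hb : IsFractionalBrownianMotion H b P)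
    (hH : 0 < H) (t s : ℝ) :
    cov[fun ω => ∫ x in (0 : ℝ)..t, b x ω, fun ω => ∫ x in (0 : ℝ)..s, b x ω; P] =
      ∫ u in (0 : ℝ)..t, ∫ v in (0 : ℝ)..s, fbmCovariance H u v := by
  obtain ⟨hg, h0, hcov⟩ := hb.isGaussianProcess_integral
  have hP : IsProbabilityMeasure P := hg.isProbabilityMeasure
  have hL : ∀ x, MemLp (b x) 2 P := fun x => (hg.hasGaussianLaw_eval (Sum.inl x)).memLp_two
  have hL' : ∀ t, MemLp (fun ω => ∫ x in (0 : ℝ)..t, b x ω) 2 P := fun t =>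
    (hg.hasGaussianLaw_eval (Sum.inr t)).memLp_two
  have h := isGaussianProcess_of_tendsto_ae (P := P)
    (X := fun n => Sum.elim (fun t ω => leftRiemannSum (fun s => b s ω) n t)
      fun t ω => ∫ s in (0 : ℝ)..t, b s ω)
    (Y := Sum.elim (fun t ω => ∫ s in (0 : ℝ)..t, b s ω)
      fun t ω => ∫ s in (0 : ℝ)..t, b s ω) ?_ ?_ ?_
  · refine tendsto_nhds_unique (h.2.2 (Sum.inl t) (Sum.inr s)) ?_
    simp only [Sum.elim_inl, Sum.elim_inr]
    simp_rw [covariance_comm _ (fun ω => ∫ x in (0 : ℝ)..s, b x ω),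
      covariance_leftRiemannSum_right (hL' s) hL, covariance_comm (fun ω => ∫ x in (0 : ℝ)..s, b x ω),
      hcov hH]
    exact tendsto_leftRiemannSum
      (intervalIntegral.continuous_parametric_intervalIntegral_of_continuous'
        (continuous_fbmCovariance hH) 0 s) t
  · intro n
    convert! isGaussianProcess_mul_sum hg (S := ℝ ⊕ ℝ)
      (Sum.elim (fun _ => Finset.range n) fun _ => {0}) (Sum.elim (fun t => t / n) fun _ => 1)
      (Sum.elim (fun t k => Sum.inl (t * (k / n))) fun u _ => Sum.inr u) using 1
    ext (u | t) ω
    · simp [leftRiemannSum]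
    · simp
  · rintro n (u | t)
    · exact integral_leftRiemannSum_eq_zero (fun x => (hL x).integrable one_le_two) hb.mean_zero n u
    · exact h0 t
  · rintro (u | t)
    · exact hb.tendsto_leftRiemannSum_ae u
    · exact ae_of_all _ fun ω => tendsto_const_nhds

lemma IsFractionalBrownianMotion.isGaussianProcess_normalizedIntegral
    (hb : IsFractionalBrownianMotion H b P) : IsGaussianProcess (normalizedIntegral H b) P := by
  have h := (hb.isGaussianProcess_integral.1.comp_right (S := ℝ) Sum.inr).smul
    fun _ => Real.sqrt (2 * H + 2)
  exact h

lemma IsFractionalBrownianMotion.integral_normalizedIntegral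
    (hb : IsFractionalBrownianMotion H b P) (t : ℝ) : P[normalizedIntegral H b t] = 0 := by
  unfold normalizedIntegral
  rw [integral_const_mul, hb.isGaussianProcess_integral.2.1, mul_zero]

lemma IsFractionalBrownianMotion.covariance_normalizedIntegral
    (hb : IsFractionalBrownianMotion H b P) (hH : 0 < H) (t s : ℝ) :
    cov[normalizedIntegral H b t, normalizedIntegral H b s; P] =
      (2 * H + 2) * ∫ u in (0 : ℝ)..t, ∫ v in (0 : ℝ)..s, fbmCovariance H u v := by
  have e : ∀ t, normalizedIntegral H b t =
    fun ω => Real.sqrt (2 * H + 2) * ∫ s in (0 : ℝ)..t, b s ω := fun t => rfl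
  rw [e, e, covariance_const_mul_left, covariance_const_mul_right, hb.covariance_integral hH,
    ← mul_assoc, Real.mul_self_sqrt (by positivity)]

end GaussianLimit

/-! ### Comparison at finitely many times, then for the maximum. -/

lemma fbm_covariance_timeChange_le {H₀ H σ τ : ℝ} (h0 : 1 / 2 < H₀) (hH : H₀ ≤ H) (h1 : H < 1)
    (hσ : 0 ≤ σ) (hστ : σ ≤ τ) :
    (2 * H₀ + 2) * ∫ u in (0 : ℝ)..σ ^ (1 / (1 + H₀)), ∫ v in (0 : ℝ)..τ ^ (1 / (1 + H₀)),
      fbmCovariance H₀ u v ≤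
    (2 * H + 2) * ∫ u in (0 : ℝ)..σ ^ (1 / (1 + H)), ∫ v in (0 : ℝ)..τ ^ (1 / (1 + H)),
      fbmCovariance H u v := by
  rcases hσ.eq_or_lt with rfl | hσ
  · have e0 : 1 / (1 + H₀) ≠ 0 := one_div_ne_zero (by linarith)
    have e1 : 1 / (1 + H) ≠ 0 := one_div_ne_zero (by linarith)
    rw [Real.zero_rpow e0, Real.zero_rpow e1]
    simp
  · rw [fbm_covariance_timeChange_eq (by linarith) hσ hστ,
      fbm_covariance_timeChange_eq (by linarith) hσ hστ]
    have hτ : 0 < τ := hσ.trans_le hστ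
    exact mul_le_mul_of_nonneg_left
      (integratedCovariance_le (div_pos hσ hτ) ((div_le_one hτ).2 hστ) h0 hH h1) (sq_nonneg _)

lemma fbm_variance_timeChange {H τ : ℝ} (hH : 1 / 2 < H) (hτ : 0 ≤ τ) :
    (2 * H + 2) * ∫ u in (0 : ℝ)..τ ^ (1 / (1 + H)), ∫ v in (0 : ℝ)..τ ^ (1 / (1 + H)),
      fbmCovariance H u v = τ ^ 2 := by
  rcases hτ.eq_or_lt with rfl | hτ
  · have e1 : 1 / (1 + H) ≠ 0 := one_div_ne_zero (by linarith)
    rw [Real.zero_rpow e1]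
    simp
  · rw [fbm_covariance_timeChange_eq (by linarith) hτ le_rfl, div_self hτ.ne',
      integratedCovariance_one (by linarith), mul_one]

lemma hasGaussianLaw_comp {Ω S ι : Type*} [MeasurableSpace Ω] [Fintype ι] {P : Measure Ω}
    {X : S → Ω → ℝ} (hX : IsGaussianProcess X P) (t : ι → S) :
    HasGaussianLaw (fun ω i => X (t i) ω) P := by
  let L : (↥(Finset.univ : Finset ι) → ℝ) →L[ℝ] ι → ℝ :=
    ContinuousLinearMap.pi fun i => .proj ⟨i, Finset.mem_univ i⟩
  exact ((hX.comp_right t).hasGaussianLaw Finset.univ).map L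

lemma IsFractionalBrownianMotion.measureReal_eq {Ω ι : Type*} [MeasurableSpace Ω] [Fintype ι]
    {P : Measure Ω} {H : ℝ} {b : ℝ → Ω → ℝ} (hb : IsFractionalBrownianMotion H b P)
    (t : ι → ℝ) (x : ℝ) :
    P.real {ω | ∀ i, normalizedIntegral H b (t i) ω ≤ x} =
      (P.map fun ω i => normalizedIntegral H b (t i) ω).real {z | ∀ i, z i ≤ x} := by
  have hm : MeasurableSet {z : ι → ℝ | ∀ i, z i ≤ x} := by
    simp only [Set.ofPred_forall]
    exact MeasurableSet.iInter fun i => measurableSet_le (measurable_pi_apply i) measurable_const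
  rw [measureReal_def, measureReal_def, Measure.map_apply_of_aemeasurable
    (hasGaussianLaw_comp hb.isGaussianProcess_normalizedIntegral t).aemeasurable hm]
  rfl

lemma IsFractionalBrownianMotion.integral_map_eq_zero {Ω ι : Type*} [MeasurableSpace Ω] [Fintype ι]
    {P : Measure Ω} {H : ℝ} {b : ℝ → Ω → ℝ} (hb : IsFractionalBrownianMotion H b P)
    (t : ι → ℝ) (i : ι) :
    ∫ z, z i ∂(P.map fun ω i => normalizedIntegral H b (t i) ω) = 0 := by
  rw [integral_map (hasGaussianLaw_comp hb.isGaussianProcess_normalizedIntegral t).aemeasurable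
    (measurable_pi_apply i).aestronglyMeasurable]
  exact hb.integral_normalizedIntegral (t i)

lemma IsFractionalBrownianMotion.covariance_map_eq {Ω ι : Type*} [MeasurableSpace Ω] [Fintype ι]
    {P : Measure Ω} {H : ℝ} {b : ℝ → Ω → ℝ} (hb : IsFractionalBrownianMotion H b P) (hH : 0 < H)
    (t : ι → ℝ) (i j : ι) :
    cov[fun z => z i, fun z => z j; P.map fun ω i => normalizedIntegral H b (t i) ω] =
      (2 * H + 2) * ∫ u in (0 : ℝ)..t i, ∫ v in (0 : ℝ)..t j, fbmCovariance H u v := by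
  rw [covariance_map_fun (measurable_pi_apply i).aestronglyMeasurable
    (measurable_pi_apply j).aestronglyMeasurable
    (hasGaussianLaw_comp hb.isGaussianProcess_normalizedIntegral t).aemeasurable]
  exact hb.covariance_normalizedIntegral hH (t i) (t j)

/-- The value of the time-changed normalized integral `s ↦ y₁ (s ^ (1 / (1 + H)))` lies below `x`
at finitely many times with a probability that increases with `H`. -/
lemma measureReal_forall_normalizedIntegral_le {Ω₀ Ω : Type*} [MeasurableSpace Ω₀]
    [MeasurableSpace Ω] {P₀ : Measure Ω₀} {P : Measure Ω} {H₀ H : ℝ} {b₀ : ℝ → Ω₀ → ℝ}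
    {b : ℝ → Ω → ℝ} (hb₀ : IsFractionalBrownianMotion H₀ b₀ P₀)
    (hb : IsFractionalBrownianMotion H b P) (h0 : 1 / 2 < H₀) (hH : H₀ ≤ H) (h1 : H < 1)
    {ι : Type*} [Fintype ι] (s : ι → ℝ) (hs : ∀ i, 0 ≤ s i) (x : ℝ) :
    P₀.real {ω | ∀ i, normalizedIntegral H₀ b₀ (s i ^ (1 / (1 + H₀))) ω ≤ x} ≤
      P.real {ω | ∀ i, normalizedIntegral H b (s i ^ (1 / (1 + H))) ω ≤ x} := by
  have hg₀ := hasGaussianLaw_comp hb₀.isGaussianProcess_normalizedIntegral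
    fun i => s i ^ (1 / (1 + H₀))
  have hg := hasGaussianLaw_comp hb.isGaussianProcess_normalizedIntegral
    fun i => s i ^ (1 / (1 + H))
  have := hg₀.isGaussian_map
  have := hg.isGaussian_map
  have hH₀0 : 0 < H₀ := by linarith
  have hH0 : 0 < H := by linarith
  rw [hb₀.measureReal_eq fun i => s i ^ (1 / (1 + H₀)),
    hb.measureReal_eq fun i => s i ^ (1 / (1 + H))]
  refine measureReal_forall_le_le_of_covariance_le (hb₀.integral_map_eq_zero _)
    (hb.integral_map_eq_zero _) (fun i => ?_) (fun i j => ?_) x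
  · rw [hb₀.covariance_map_eq hH₀0, hb.covariance_map_eq hH0, fbm_variance_timeChange h0 (hs i),
      fbm_variance_timeChange (h0.trans_le hH) (hs i)]
  -- The kernel comparison is available for ordered times; symmetry of the covariance gives the
  -- other order.
  · wlog hij : s i ≤ s j generalizing i j
    · rw [covariance_comm, covariance_comm (fun z : ι → ℝ => z i)]
      exact this j i (le_of_not_ge hij)
    rw [hb₀.covariance_map_eq hH₀0, hb.covariance_map_eq hH0]
    exact fbm_covariance_timeChange_le h0 hH h1 (hs i) hij

lemma continuous_normalizedIntegral {Ω : Type*} {H : ℝ} {b : ℝ → Ω → ℝ} {ω : Ω}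
    (hω : Continuous fun x => b x ω) : Continuous fun t => normalizedIntegral H b t ω :=
  continuous_const.mul (intervalIntegral.continuous_primitive
    (fun _ _ => hω.intervalIntegrable _ _) 0)

/-- The change of time is a continuous map of `[0, 1]` onto itself, with inverse `t ↦ t ^ (1 + H)`.
Hence one dense sequence `d`, chosen independently of `H`, detects the maximum of every continuous
path. -/
lemma maxNormalizedIntegral_le_iff {Ω : Type*} {H x : ℝ} (hH : 0 < 1 + H) {b : ℝ → Ω → ℝ} {ω : Ω}
    (hω : Continuous fun x => b x ω) {d : ℕ → Icc (0 : ℝ) 1} (hd : DenseRange d) :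
    maxNormalizedIntegral H b ω ≤ x ↔
      ∀ n, normalizedIntegral H b ((d n : ℝ) ^ (1 / (1 + H))) ω ≤ x := by
  have hc := continuous_normalizedIntegral (H := H) hω
  have hbdd := (isCompact_Icc (a := (0 : ℝ)) (b := 1)).bddAbove_image hc.continuousOn
  have hne : ((fun t => normalizedIntegral H b t ω) '' Icc (0 : ℝ) 1).Nonempty :=
    (nonempty_Icc.2 zero_le_one).image _
  rw [maxNormalizedIntegral, csSup_le_iff hbdd hne, forall_mem_image]
  have hp : 0 ≤ 1 / (1 + H) := (one_div_pos.2 hH).le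
  constructor
  · exact fun h n => h ⟨Real.rpow_nonneg (d n).2.1 _, Real.rpow_le_one (d n).2.1 (d n).2.2 hp⟩
  · intro h t ht
    have hall : ∀ s : Icc (0 : ℝ) 1, normalizedIntegral H b ((s : ℝ) ^ (1 / (1 + H))) ω ≤ x :=
      isClosed_property hd (isClosed_le (hc.comp
        (continuous_subtype_val.rpow_const fun _ => Or.inr hp)) continuous_const) h
    have := hall ⟨t ^ (1 + H), Real.rpow_nonneg ht.1 _, Real.rpow_le_one ht.1 ht.2 hH.le⟩
    rwa [← Real.rpow_mul ht.1, mul_one_div_cancel hH.ne', Real.rpow_one] at this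

lemma IsFractionalBrownianMotion.tendsto_measureReal_forall {Ω : Type*} [MeasurableSpace Ω]
    {P : Measure Ω} {H : ℝ} {b : ℝ → Ω → ℝ} (hb : IsFractionalBrownianMotion H b P)
    (hH : 0 < 1 + H) {d : ℕ → Icc (0 : ℝ) 1} (hd : DenseRange d) (x : ℝ) :
    Tendsto (fun n : ℕ => P.real {ω | ∀ i : Fin n,
      normalizedIntegral H b ((d i : ℝ) ^ (1 / (1 + H))) ω ≤ x}) atTop
      (𝓝 (maxDistribution P H b x)) := by
  have hP : IsProbabilityMeasure P := hb.isGaussianProcess.isProbabilityMeasure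
  have h1 := tendsto_measure_iInter_atTop (μ := P) (s := fun n : ℕ => {ω | ∀ i : Fin n,
      normalizedIntegral H b ((d i : ℝ) ^ (1 / (1 + H))) ω ≤ x}) (fun n => ?_)
    (fun m n hmn ω hω i => hω (Fin.castLE hmn i)) ⟨0, measure_ne_top _ _⟩
  · have h2 : P (⋂ n : ℕ, {ω | ∀ i : Fin n,
        normalizedIntegral H b ((d i : ℝ) ^ (1 / (1 + H))) ω ≤ x}) =
        P {ω | maxNormalizedIntegral H b ω ≤ x} := by
      -- The two events agree only on continuous paths, that is, almost surely.
      refine measure_congr ?_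
      filter_upwards [hb.continuous_paths] with ω hω
      refine propext ?_
      change (ω ∈ ⋂ n : ℕ, {ω | ∀ i : Fin n,
        normalizedIntegral H b ((d i : ℝ) ^ (1 / (1 + H))) ω ≤ x}) ↔ maxNormalizedIntegral H b ω ≤ x
      rw [maxNormalizedIntegral_le_iff hH hω hd, mem_iInter]
      exact ⟨fun h n => h (n + 1) (Fin.last n), fun h n i => h i⟩
    rw [h2] at h1
    exact (ENNReal.tendsto_toReal (measure_ne_top _ _)).comp h1
  · simp only [Set.ofPred_forall]
    exact NullMeasurableSet.iInter fun i => nullMeasurableSet_le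
      (hb.isGaussianProcess_normalizedIntegral.aemeasurable _) aemeasurable_const

theorem maxDistribution_le_of_le {Ω₀ Ω : Type*} [MeasurableSpace Ω₀]
    [MeasurableSpace Ω] {P₀ : Measure Ω₀} {P : Measure Ω} {H₀ H : ℝ} {b₀ : ℝ → Ω₀ → ℝ}
    {b : ℝ → Ω → ℝ} (hb₀ : IsFractionalBrownianMotion H₀ b₀ P₀)
    (hb : IsFractionalBrownianMotion H b P) (h0 : 1 / 2 < H₀) (hH : H₀ ≤ H) (h1 : H < 1) (x : ℝ) :
    maxDistribution P₀ H₀ b₀ x ≤ maxDistribution P H b x := by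
  have hd := TopologicalSpace.denseRange_denseSeq (Icc (0 : ℝ) 1)
  exact le_of_tendsto_of_tendsto' (hb₀.tendsto_measureReal_forall (by linarith) hd x)
    (hb.tendsto_measureReal_forall (by linarith) hd x) fun n =>
      measureReal_forall_normalizedIntegral_le hb₀ hb h0 hH h1 _
        (fun i : Fin n => (TopologicalSpace.denseSeq (Icc (0 : ℝ) 1) i).2.1) x

/-! ### Slow variation and the comparison of exponents. -/

/-- A quotient of two slowly varying functions along powers of `x` is not eventually smaller than
a positive power of `x`. -/
lemma IsSlowlyVaryingAtZero.not_eventually_div_le {L L' : ℝ → ℝ} (hL : IsSlowlyVaryingAtZero L)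
    (hL' : IsSlowlyVaryingAtZero L') {p p' δ : ℝ} (hp : 0 < p) (hp' : 0 < p') (hδ : 0 < δ) :
    ¬ ∀ᶠ z in 𝓝[>] (0 : ℝ), L (z ^ p) / L' (z ^ p') ≤ z ^ δ := by
  intro h
  have hpow : ∀ q : ℝ, 0 < q → Tendsto (fun z : ℝ => z ^ q) (𝓝[>] 0) (𝓝[>] 0) := by
    intro q hq
    refine tendsto_nhdsWithin_iff.2 ⟨?_, ?_⟩
    · have := (Real.continuousAt_rpow_const 0 q (Or.inr hq.le)).tendsto
      rw [Real.zero_rpow hq.ne'] at this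
      exact this.mono_left nhdsWithin_le_nhds
    · filter_upwards [self_mem_nhdsWithin] with z hz using Real.rpow_pos_of_pos hz q
  have hz : Tendsto (fun n : ℕ => (1 / 2 : ℝ) ^ n) atTop (𝓝[>] 0) :=
    tendsto_nhdsWithin_iff.2 ⟨tendsto_pow_atTop_nhds_zero_of_lt_one (by norm_num) (by norm_num),
      Eventually.of_forall fun n => by simp only [mem_Ioi]; positivity⟩
  have hpos : ∀ {L : ℝ → ℝ} (_ : IsSlowlyVaryingAtZero L) {q : ℝ}, 0 < q →
      ∀ᶠ n : ℕ in atTop, 0 < L (((1 / 2 : ℝ) ^ n) ^ q) := by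
    intro L hL q hq
    obtain ⟨⟨ε, hε, -, hLε⟩, -⟩ := hL
    have : ∀ᶠ x in 𝓝[>] (0 : ℝ), 0 < L x := by
      filter_upwards [Ioo_mem_nhdsGT hε] with x hx using hLε x hx
    exact ((hpow q hq).comp hz).eventually this
  have hrat : ∀ {L : ℝ → ℝ} (_ : IsSlowlyVaryingAtZero L) {q : ℝ}, 0 < q →
      Tendsto (fun n : ℕ => L (((1 / 2 : ℝ) ^ (n + 1)) ^ q) / L (((1 / 2 : ℝ) ^ n) ^ q)) atTop
        (𝓝 1) := by
    intro L hL q hq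
    refine ((hL.2 ((1 / 2) ^ q) (by positivity)).comp ((hpow q hq).comp hz)).congr fun n => ?_
    simp only [Function.comp_apply]
    rw [pow_succ', Real.mul_rpow (by norm_num) (by positivity)]
  -- Along `z = 2 ^ (-n)` the assumed bound is `r ^ (2 * n)`. Half of the exponent is spent on
  -- dividing by `r ^ n`: the sequence `a` is then dominated by `r ^ n` and summable, yet slow
  -- variation makes its successive ratios tend to `r⁻¹ > 1`.
  set r : ℝ := (1 / 2) ^ (δ / 2) with hr
  have hr0 : 0 < r := by positivity
  have hr1 : r < 1 := Real.rpow_lt_one (by norm_num) (by norm_num) (by positivity)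
  have hzδ : ∀ n : ℕ, ((1 / 2 : ℝ) ^ n) ^ δ = r ^ n * r ^ n := by
    intro n
    rw [hr, ← mul_pow, ← Real.rpow_add (by norm_num), add_halves, ← Real.rpow_natCast,
      ← Real.rpow_natCast, ← Real.rpow_mul (by norm_num), ← Real.rpow_mul (by norm_num), mul_comm]
  set a : ℕ → ℝ := fun n => L (((1 / 2 : ℝ) ^ n) ^ p) / L' (((1 / 2 : ℝ) ^ n) ^ p') / r ^ n with ha
  have hsum : Summable a := by
    refine Summable.of_norm_bounded_eventually_nat (g := fun n => r ^ n)
      (summable_geometric_of_lt_one hr0.le hr1) ?_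
    filter_upwards [hz.eventually h, hpos hL hp, hpos hL' hp'] with n hn h1 h2
    rw [Real.norm_of_nonneg (by positivity), ha]
    simp only
    rw [div_le_iff₀ (by positivity), ← hzδ]
    exact hn
  refine not_summable_of_ratio_test_tendsto_gt_one (l := r⁻¹) ((one_lt_inv₀ hr0).2 hr1) ?_ hsum
  have hlim := ((hrat hL hp).div (hrat hL' hp') one_ne_zero).mul_const r⁻¹
  rw [div_one, one_mul] at hlim
  refine hlim.congr' ?_
  filter_upwards [hpos hL hp, hpos hL' hp', (tendsto_add_atTop_nat 1).eventually (hpos hL hp),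
    (tendsto_add_atTop_nat 1).eventually (hpos hL' hp')] with n h1 h2 h3 h4
  rw [Real.norm_of_nonneg (by positivity), Real.norm_of_nonneg (by positivity)]
  simp only [ha, Pi.div_apply]
  rw [pow_succ r]
  field_simp

/-- Substituting `x = z ^ (1 / (1 + H))` puts the expansions for different `H` at the same level
`z`, where (a) compares them. -/
lemma eventually_eq_rpow_div_mul {F L : ℝ → ℝ} {H θ : ℝ} (hH : 0 < 1 + H)
    (h : ∀ᶠ x : ℝ in 𝓝[>] 0, F (x ^ (1 + H)) = x ^ θ * L x) :
    ∀ᶠ z : ℝ in 𝓝[>] 0, F z = z ^ (θ / (1 + H)) * L (z ^ (1 / (1 + H))) := by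
  have hp : 0 < 1 / (1 + H) := one_div_pos.2 hH
  have ht : Tendsto (fun z : ℝ => z ^ (1 / (1 + H))) (𝓝[>] 0) (𝓝[>] 0) := by
    refine tendsto_nhdsWithin_iff.2 ⟨?_, ?_⟩
    · have := (Real.continuousAt_rpow_const 0 _ (Or.inr hp.le)).tendsto
      rw [Real.zero_rpow hp.ne'] at this
      exact this.mono_left nhdsWithin_le_nhds
    · filter_upwards [self_mem_nhdsWithin] with z hz using Real.rpow_pos_of_pos hz _
  filter_upwards [ht.eventually h, self_mem_nhdsWithin] with z hz hz0
  rw [← Real.rpow_mul (le_of_lt hz0), one_div_mul_cancel hH.ne', Real.rpow_one] at hz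
  rw [hz, ← Real.rpow_mul (le_of_lt hz0), one_div_mul_eq_div]

theorem mainTheorem3
    {Ω : ℝ → Type*} [∀ H, MeasurableSpace (Ω H)] (P : ∀ H, Measure (Ω H))
    (b : ∀ H : ℝ, ℝ → Ω H → ℝ)
    (hb : ∀ H ∈ Ioo (1 / 2 : ℝ) 1, IsFractionalBrownianMotion H (b H) (P H)) :
    (∀ x : ℝ, 0 < x →
      MonotoneOn (fun H : ℝ => maxDistribution (P H) H (b H) x) (Ioo (1 / 2 : ℝ) 1)) ∧
    (∀ (S : Set ℝ) (θ : ℝ → ℝ) (L : ℝ → ℝ → ℝ), S ⊆ Ioo (1 / 2 : ℝ) 1 →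
      (∀ H ∈ S, IsSlowlyVaryingAtZero (L H) ∧
        ∀ᶠ x : ℝ in 𝓝[>] 0,
          maxDistribution (P H) H (b H) (x ^ (1 + H)) = x ^ θ H * L H x) →
      AntitoneOn (fun H : ℝ => θ H / (1 + H)) S) := by
  refine ⟨fun x _ H₀ h0 H h1 hH =>
    maxDistribution_le_of_le (hb H₀ h0) (hb H h1) h0.1 hH h1.2 x, ?_⟩
  intro S θ L hS hL H₀ h0 H h1 hH
  -- The positive gap between the normalized exponents serves as `δ`: part (a) at level `z` bounds
  -- the quotient of the slowly varying factors by `z ^ δ`.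
  by_contra! hlt
  have hp₀ : 0 < 1 + H₀ := by linarith [(hS h0).1]
  have hp : 0 < 1 + H := by linarith [(hS h1).1]
  refine (hL H₀ h0).1.not_eventually_div_le (hL H h1).1 (one_div_pos.2 hp₀) (one_div_pos.2 hp)
    (sub_pos.2 hlt) ?_
  have hpos : ∀ᶠ z : ℝ in 𝓝[>] 0, 0 < L H (z ^ (1 / (1 + H))) := by
    obtain ⟨⟨ε, hε, -, hLε⟩, -⟩ := (hL H h1).1
    filter_upwards [Ioo_mem_nhdsGT (show 0 < ε ^ (1 + H) by positivity)] with z hz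
    refine hLε _ ⟨Real.rpow_pos_of_pos hz.1 _, ?_⟩
    have := Real.rpow_lt_rpow hz.1.le hz.2 (one_div_pos.2 hp)
    rwa [← Real.rpow_mul hε.le, mul_one_div_cancel hp.ne', Real.rpow_one] at this
  filter_upwards [eventually_eq_rpow_div_mul hp₀ (hL H₀ h0).2,
    eventually_eq_rpow_div_mul hp (hL H h1).2, hpos, self_mem_nhdsWithin] with z e₀ e hLz hz
  have hz : 0 < z := hz
  have hle := maxDistribution_le_of_le (hb H₀ (hS h0)) (hb H (hS h1)) (hS h0).1 hH (hS h1).2 z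
  rw [e₀, e] at hle
  rw [div_le_iff₀ hLz, Real.rpow_sub hz, div_mul_eq_mul_div, le_div_iff₀ (by positivity)]
  linarith
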